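/- Let $P,X,Y,E$ be finite-dimensional Euclidean spaces with dual spaces $P^*,X^*,Y^*,E^*$. Let $g\colon P\times X\to Y$, $C\subset Y$ and $f\colon P\times X\to X^*$, and put $\Gamma(p):=\{x\in X : g(p,x)\in C\}$. For a set $\Omega$ and $x\in\Omega$, let $T_\Omega(x)$ be the contingent cone and $N_\Omega(x)$ the limiting normal cone (with $N_\Omega(x)=\emptyset$ for $x\notin\Omega$), and let $\mathcal K_\Omega(x,x^*):=T_\Omega(x)\cap\{x^*\}^\perp$. Define $$S(p):=\{x\in X : 0\in f(p,x)+N_{\Gamma(p)}(x)\},$$ and fix $\bar z=(\bar p,\bar x)$ with $\bar x\in S(\bar p)$. Assume that $g$ is of class $C^2$ and $f$ is of class $C^1$ around $\bar z$, and that the closed set $C$ is $C^2$-reducible at $g(\bar z)$ to a closed convex cone $K\subset E$: there are an open neighborhood $V$ of $g(\bar z)$ and a $C^2$ map $h\colon V\to E$ with $h(g(\bar z))=0$, $\nabla h(g(\bar z))$ surjective and $C\cap V=\{y\in V : h(y)\in K\}$. For $\lambda\in N_C(g(\bar z))$ let $\mu_\lambda\in E^*$ be the unique functional with $\nabla h(g(\bar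 z))^*\mu_\lambda=\lambda$, and define $\mathcal F_\lambda\colon X\to X^*$ by $$\mathcal F_\lambda u:=\nabla_xf(\bar z)u+\nabla_x^2\langle\lambda,g(\cdot)\rangle(\bar z)u+\nabla_xg(\bar z)^*\,\nabla^2\langle\mu_\lambda,h(\cdot)\rangle(g(\bar z))\,\nabla_xg(\bar z)u .$$ Let $\bar\Lambda:=\{\lambda\in N_C(g(\bar z)) : f(\bar z)+\nabla_xg(\bar z)^*\lambda=0\}$ and $\Lambda(\bar z,z^*):=\{\lambda\in N_C(g(\bar z)) : \nabla g(\bar z)^*\lambda=z^*\}$, and let $\Lambda(\bar z,z^*;v)$ be the set of maximizers over $\lambda\in\Lambda(\bar z,z^*)$ of $$\langle\lambda,\nabla^2g(\bar z)(v,v)\rangle+\nabla^2\langle\mu_\lambda,h(\cdot)\rangle(g(\bar z))\big(\nabla g(\bar z)v,\nabla g(\bar z)v\big).$$ Write $\mathcal K:=\mathcal K_{\Gamma(\bar p)}(\bar x,-f(\bar z))$. With $G:=h\circ g$ and $\operatorname{lin}K:=K\cap(-K)$, let $$\mathcal P:=\{q\in P : \nabla_pG(\bar z)q\in\operatorname{rge}\nabla_xG(\bar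 z)+\operatorname{lin}K\}.$$ Assume Robinson stability of $g(p,x)\in C$ at $(\bar p,\bar x)$: there are $\kappa\ge0$ and neighborhoods $W$ of $\bar p$ and $U$ of $\bar x$ with $\operatorname{dist}(x;\Gamma(p))\le\kappa\operatorname{dist}(g(p,x);C)$ for all $(p,x)\in W\times U$ (where $\operatorname{dist}(x;\emptyset)=\infty$). Suppose that one of the following holds. (i) For every $0\ne u\in\mathcal K$, every $\lambda\in\bar\Lambda$ and every $\hat\lambda\in\Lambda(\bar z,\nabla g(\bar z)^*\lambda;(0,u))$, either $\langle\mathcal F_{\hat\lambda}u,u\rangle>0$ or $\langle\mathcal F_{\hat\lambda}u,\tilde u\rangle<0$ for some $\tilde u\in\mathcal K$; and moreover either $\mathcal P=P$ or $K$ is polyhedral. (ii) Strict complementarity holds for the system $g(\bar p,x)\in C$ at $(\bar x,-f(\bar z))$, i.e. there is $\mu\in\operatorname{ri}N_C(g(\bar z))$ with $\nabla_xg(\bar z)^*\mu=-f(\bar z)$; and for every $0\ne u\in\mathcal K$ and every $\lambda\in\bar\Lambda$, either $\langle\mathcal F_\lambda u,u\rangle>0$ or $\langle\mathcal F_\lambda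 u,\tilde u\rangle<0$ for some $\tilde u\in\mathcal K$. Then $S$ is isolatedly calm at $(\bar p,\bar x)$: there are $\ell>0$ and neighborhoods $Q$ of $\bar p$ and $U$ of $\bar x$ such that $\|x-\bar x\|\le\ell\|p-\bar p\|$ for all $p\in Q$ and all $x\in S(p)\cap U$. -/

import Mathlib

open Filter Topology
open scoped NNReal ENNReal

noncomputable section

namespace ParamVar

section General

variable {Z : Type*} [NormedAddCommGroup Z] [NormedSpace ℝ Z]

/-- The regular (Fréchet) normal cone to `Ω` at `z`: the functionals `zs` with
`limsup ⟨zs, w - z⟩ / ‖w - z‖ ≤ 0` as `w → z` in `Ω`. It is empty if `z ∉ Ω`. -/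
def regularNormalCone (Ω : Set Z) (z : Z) : Set (StrongDual ℝ Z) :=
  {zs | z ∈ Ω ∧ ∀ ε : ℝ, 0 < ε → ∀ᶠ w in 𝓝[Ω] z, zs (w - z) ≤ ε * ‖w - z‖}

/-- The limiting (Mordukhovich) normal cone to `Ω` at `z`. It is empty if `z ∉ Ω`. -/
def normalCone (Ω : Set Z) (z : Z) : Set (StrongDual ℝ Z) :=
  {zs | z ∈ Ω ∧ ∃ (w : ℕ → Z) (ws : ℕ → StrongDual ℝ Z),
    Tendsto w atTop (𝓝 z) ∧ (∀ k, w k ∈ Ω) ∧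
    (∀ k, ws k ∈ regularNormalCone Ω (w k)) ∧ Tendsto ws atTop (𝓝 zs)}

/-- The critical cone to `Ω` at `(z, zs)`: the contingent cone `T_Ω(z)` intersected with the
orthogonal complement of `zs`. -/
def criticalCone (Ω : Set Z) (z : Z) (zs : StrongDual ℝ Z) : Set Z :=
  posTangentConeAt Ω z ∩ {w | zs w = 0}

/-- The Hessian of a real-valued function, as a continuous bilinear form. -/
def hessian (φ : Z → ℝ) (z : Z) : Z →L[ℝ] Z →L[ℝ] ℝ :=
  fderiv ℝ (fderiv ℝ φ) z

end General

section Cone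

variable {E : Type*} [NormedAddCommGroup E] [InnerProductSpace ℝ E]

/-- A closed convex cone is polyhedral if it is an intersection of finitely many half-spaces
`{e | 0 ≤ ⟪a, e⟫}`. -/
def IsPolyhedral (K : ProperCone ℝ E) : Prop :=
  PointedCone.DualFG (innerₗ E) K.toPointedCone

end Cone

variable {P X Y E : Type*}
  [NormedAddCommGroup P] [InnerProductSpace ℝ P]
  [NormedAddCommGroup X] [InnerProductSpace ℝ X]
  [NormedAddCommGroup Y] [InnerProductSpace ℝ Y]
  [NormedAddCommGroup E] [InnerProductSpace ℝ E]

/-- `C` is `C²`-reducible at `y ∈ C` to the closed convex cone `K` by means of `h`. Only the values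
of `h` near `y` matter. -/
structure IsConeReduction (C : Set Y) (y : Y) (K : ProperCone ℝ E) (h : Y → E) : Prop where
  isClosed : IsClosed C
  mem : y ∈ C
  map_eq_zero : h y = 0
  surjective : Function.Surjective (fderiv ℝ h y)
  exists_nhd : ∃ V : Set Y, IsOpen V ∧ y ∈ V ∧ ContDiffOn ℝ 2 h V ∧
    C ∩ V = {w | w ∈ V ∧ h w ∈ K}

/-- The multiplier `μ` with `∇h(y)^* μ = l`, that is `(∇h(y)^*)⁻¹ l`. It is unique if `∇h(y)` is
surjective, and it exists for every normal `l` to a set reduced by `h` at `y`. -/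
def reducedMultiplier (h : Y → E) (y : Y) (l : StrongDual ℝ Y) : StrongDual ℝ E :=
  Function.invFun (fun μ : StrongDual ℝ E => μ.comp (fderiv ℝ h y)) l

theorem reducedMultiplier_comp {h : Y → E} {y : Y}
    (hs : Function.Surjective (fderiv ℝ h y)) (μ : StrongDual ℝ E) :
    reducedMultiplier h y (μ.comp (fderiv ℝ h y)) = μ := by
  have hinj : Function.Injective (fun μ : StrongDual ℝ E => μ.comp (fderiv ℝ h y)) := by
    intro a b hab
    ext e
    obtain ⟨w, rfl⟩ := hs e
    exact DFunLike.congr_fun hab w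
  exact Function.leftInverse_invFun hinj μ

/-- The curvature form `∇²⟨(∇h(y)^*)⁻¹ l, h(·)⟩(y)`. -/
def curvature (h : Y → E) (y : Y) (l : StrongDual ℝ Y) : Y →L[ℝ] Y →L[ℝ] ℝ :=
  hessian (fun w => reducedMultiplier h y l (h w)) y

/-- The partial derivative `∇ₓ g(z)` at `z = (p, x)`. -/
def partialX {F : Type*} [NormedAddCommGroup F] [NormedSpace ℝ F] (g : P × X → F) (z : P × X) :
    X →L[ℝ] F :=
  (fderiv ℝ g z).comp (ContinuousLinearMap.inr ℝ P X)

/-- The partial derivative `∇ₚ g(z)` at `z = (p, x)`. -/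
def partialP {F : Type*} [NormedAddCommGroup F] [NormedSpace ℝ F] (g : P × X → F) (z : P × X) :
    P →L[ℝ] F :=
  (fderiv ℝ g z).comp (ContinuousLinearMap.inl ℝ P X)

/-- The constraint map `Γ(p) = {x | g(p, x) ∈ C}`. -/
def feasible (g : P × X → Y) (C : Set Y) (p : P) : Set X :=
  {x | g (p, x) ∈ C}

/-- Robinson stability of `g(p, x) ∈ C` at `z = (p̄, x̄)`. The distance to the empty set is `∞`. -/
def RobinsonStable (g : P × X → Y) (C : Set Y) (z : P × X) : Prop :=
  ∃ κ : ℝ≥0, ∃ W ∈ 𝓝 z.1, ∃ U ∈ 𝓝 z.2, ∀ p ∈ W, ∀ x ∈ U,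
    Metric.infEDist x (feasible g C p) ≤ κ * Metric.infEDist (g (p, x)) C

/-- Strict complementarity for the system `G(w) ∈ C` at `(w, ws)`: there is `μ` in the relative
interior of `N_C(G(w))` with `∇G(w)^* μ = ws`. -/
def StrictComplementarity (G : X → Y) (C : Set Y) (w : X) (ws : StrongDual ℝ X) : Prop :=
  ∃ μ ∈ intrinsicInterior ℝ (normalCone C (G w)), μ.comp (fderiv ℝ G w) = ws

/-- The characteristic subspace of parameters `q` with
`∇ₚ(h ∘ g)(z) q ∈ rge ∇ₓ(h ∘ g)(z) + lin K`. -/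
def charSubspace (g : P × X → Y) (h : Y → E) (K : ProperCone ℝ E) (z : P × X) :
    Submodule ℝ P :=
  (LinearMap.range (partialX (h ∘ g) z : X →ₗ[ℝ] E) ⊔ K.toPointedCone.lineal).comap
    (partialP (h ∘ g) z : P →ₗ[ℝ] E)

/-- The multiplier set `Λ(z, zs)`. -/
def multipliers (g : P × X → Y) (C : Set Y) (z : P × X) (zs : StrongDual ℝ (P × X)) :
    Set (StrongDual ℝ Y) :=
  {l | l ∈ normalCone C (g z) ∧ l.comp (fderiv ℝ g z) = zs}

/-- The objective of the directional multiplier problem,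
`⟨l, ∇²g(z)(v, v)⟩ + ∇²⟨(∇h(g(z))^*)⁻¹ l, h(·)⟩(g(z))(∇g(z)v, ∇g(z)v)`. -/
def dirObjective (g : P × X → Y) (h : Y → E) (z v : P × X) (l : StrongDual ℝ Y) : ℝ :=
  l (fderiv ℝ (fderiv ℝ g) z v v) + curvature h (g z) l (fderiv ℝ g z v) (fderiv ℝ g z v)

/-- The directional multiplier set `Λ(z, zs; v)`: the maximizers of `dirObjective` over
`Λ(z, zs)`. -/
def dirMultipliers (g : P × X → Y) (C : Set Y) (h : Y → E) (z : P × X)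
    (zs : StrongDual ℝ (P × X)) (v : P × X) : Set (StrongDual ℝ Y) :=
  {l | l ∈ multipliers g C z zs ∧
    ∀ l' ∈ multipliers g C z zs, dirObjective g h z v l' ≤ dirObjective g h z v l}

/-- The multiplier set `Λ̄ = {l ∈ N_C(g(z)) | f(z) + ∇ₓg(z)^* l = 0}`. -/
def systemMultipliers (f : P × X → StrongDual ℝ X) (g : P × X → Y) (C : Set Y) (z : P × X) :
    Set (StrongDual ℝ Y) :=
  {l | l ∈ normalCone C (g z) ∧ f z + l.comp (partialX g z) = 0}

/-- The operator
`F_l u = ∇ₓf(z)u + ∇ₓ²⟨l, g(·)⟩(z)u + ∇ₓg(z)^* ∇²⟨(∇h(g(z))^*)⁻¹ l, h(·)⟩(g(z)) ∇ₓg(z)u`. -/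
def opF (f : P × X → StrongDual ℝ X) (g : P × X → Y) (h : Y → E) (z : P × X)
    (l : StrongDual ℝ Y) : X →L[ℝ] StrongDual ℝ X :=
  partialX f z + hessian (fun x => l (g (z.1, x))) z.2 +
    (curvature h (g z) l).bilinearComp (partialX g z) (partialX g z)

/-- The second-order condition with directional multipliers. -/
def SecondOrderCondition (f : P × X → StrongDual ℝ X) (g : P × X → Y) (C : Set Y) (h : Y → E)
    (z : P × X) : Prop :=
  ∀ u ∈ criticalCone (feasible g C z.1) z.2 (-f z), u ≠ 0 →
    ∀ l ∈ systemMultipliers f g C z,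
      ∀ l' ∈ dirMultipliers g C h z (l.comp (fderiv ℝ g z)) (0, u),
        0 < opF f g h z l' u u ∨
          ∃ u' ∈ criticalCone (feasible g C z.1) z.2 (-f z), opF f g h z l' u u' < 0

/-- The second-order condition over all multipliers. -/
def StrongSecondOrderCondition (f : P × X → StrongDual ℝ X) (g : P × X → Y) (C : Set Y)
    (h : Y → E) (z : P × X) : Prop :=
  ∀ u ∈ criticalCone (feasible g C z.1) z.2 (-f z), u ≠ 0 →
    ∀ l ∈ systemMultipliers f g C z,
      0 < opF f g h z l u u ∨
        ∃ u' ∈ criticalCone (feasible g C z.1) z.2 (-f z), opF f g h z l u u' < 0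

/-- The solution map `S(p) = {x | 0 ∈ f(p, x) + N_{Γ(p)}(x)}`. -/
def solutionMap (f : P × X → StrongDual ℝ X) (g : P × X → Y) (C : Set Y) (p : P) : Set X :=
  {x | ∃ ν ∈ normalCone (feasible g C p) x, 0 = f (p, x) + ν}

/-- Isolated calmness of a set-valued map `S` at `(p̄, x̄)`. -/
def IsolatedlyCalm (S : P → Set X) (pbar : P) (xbar : X) : Prop :=
  ∃ ℓ : ℝ, 0 < ℓ ∧ ∃ Q ∈ 𝓝 pbar, ∃ U ∈ 𝓝 xbar, ∀ p ∈ Q,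
    S p ∩ U ⊆ Metric.closedBall xbar (ℓ * ‖p - pbar‖)

end ParamVar

end

open ParamVar

namespace ParamVar

/-! ### Finitely generated cones: conic Carathéodory and Hoffman-type bounds on coefficients. -/

section Caratheodory

variable {ι W : Type*} [Fintype ι] [NormedAddCommGroup W] [NormedSpace ℝ W]

/-! Write `G = h ∘ g`, so that locally the constraint is `G ∈ K` with `G z = 0`. If isolated
calmness fails, there are solutions `z_k → z` with `‖p_k - p̄‖ = o(t_k)`, where `t_k = ‖x_k - x̄‖`.
The directions `(z_k - z) / t_k` then cluster at some `(0, u)` with `‖u‖ = 1`. Robinson stability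
yields multipliers `μ_k` in the polar of `K`, complementary to `G z_k` and bounded by `κ ‖f z_k‖`; a
subsequence converges to some `μ₀`. This is recorded in `DirectionalSolutions`
(`exists_directionalSolutions`).

First order: subtract the limiting stationarity equation and divide by `t_k`. Then `t_k⁻¹ (μ_k - μ₀)
∘ ∇ₓG → -L u`, where `L` is `lagrangeDeriv`, i.e. the operator `F` at the multiplier `μ₀ ∘ ∇h`. For
critical `w` the left side is nonpositive, so `⟨L u, w⟩ ≥ 0` (`lagrangeDeriv_nonneg`). This rules
out the negative alternative of either second-order condition.

Second order: complementarity and Taylor expansion give `t_k⁻² μ₀(G z_k) → ⟨L u, u⟩`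
(`tendsto_limit_apply`), provided `t_k⁻¹ (μ_k - μ₀)(∇ₚG v_k) → 0` for the parameter parts `v_k` of
the directions. The left side is nonpositive, so `⟨L u, u⟩ = 0`; the same limit shows that `μ₀` is a
directional maximizer (`maximal`), contradicting (i). The proviso holds if the characteristic
subspace is all of `P`. If `K` is polyhedral, a Hoffman-type argument replaces `μ_k` by multipliers
with the same image under `∇ₓG^*` at distance `O(t_k)` from `μ₀`.

In case (ii) no second-order limit is needed: strict complementarity makes `-u` critical too, so `⟨L
u, u⟩ ≤ 0`. -/

theorem exists_linearIndepOn_nonneg_combination (b : ι → W) (c : ι → ℝ) (hc : 0 ≤ c) :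
    ∃ c' : ι → ℝ, 0 ≤ c' ∧ (∀ i, c i = 0 → c' i = 0) ∧ ∑ i, c' i • b i = ∑ i, c i • b i ∧
      ∀ d : ι → ℝ, (∀ i, c' i = 0 → d i = 0) → ∑ i, d i • b i = 0 → d = 0 := by
  classical
  induction hn : (Finset.univ.filter fun i => c i ≠ 0).card using Nat.strong_induction_on
    generalizing c with
  | _ n ih =>
  by_cases hind : ∀ d : ι → ℝ, (∀ i, c i = 0 → d i = 0) → ∑ i, d i • b i = 0 → d = 0
  · exact ⟨c, hc, fun _ h => h, rfl, hind⟩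
  push Not at hind
  obtain ⟨d₀, hd₀, hsum₀, hne₀⟩ := hind
  obtain ⟨d, hd, hsum, i₀, hi₀⟩ : ∃ d : ι → ℝ, (∀ i, c i = 0 → d i = 0) ∧
      ∑ i, d i • b i = 0 ∧ ∃ i, 0 < d i := by
    obtain ⟨i, hi⟩ := Function.ne_iff.1 hne₀
    rcases lt_or_gt_of_ne hi with h | h
    · exact ⟨-d₀, fun i hi => by simp [hd₀ i hi], by simp [hsum₀], i, by simpa using h⟩
    · exact ⟨d₀, hd₀, hsum₀, i, h⟩
  obtain ⟨j, hj, hmin⟩ := Finset.exists_min_image (Finset.univ.filter fun i => 0 < d i)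
    (fun i => c i / d i) ⟨i₀, by simpa using hi₀⟩
  simp only [Finset.mem_filter, Finset.mem_univ, true_and] at hj hmin
  -- The smallest ratio: moving along `-d` by `τ` keeps all coefficients nonnegative and makes the
  -- `j`-th one vanish, so the support shrinks.
  set τ := c j / d j with hτ
  have hτ0 : 0 ≤ τ := div_nonneg (hc j) hj.le
  have hc1 : 0 ≤ c - τ • d := by
    intro i
    simp only [Pi.zero_apply, Pi.sub_apply, Pi.smul_apply, smul_eq_mul, sub_nonneg]
    rcases lt_or_ge 0 (d i) with h | h
    · exact (le_div_iff₀ h).1 (hmin i h)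
    · exact (mul_nonpos_of_nonneg_of_nonpos hτ0 h).trans (hc i)
  have hzero : ∀ i, c i = 0 → (c - τ • d) i = 0 := fun i hi => by simp [hi, hd i hi]
  have hcj : c j ≠ 0 := fun h => hj.ne' (hd j h)
  have hlt : (Finset.univ.filter fun i => (c - τ • d) i ≠ 0).card < n := by
    rw [← hn]
    refine Finset.card_lt_card ⟨fun i hi => ?_, fun hsub => ?_⟩
    · simp only [Finset.mem_filter, Finset.mem_univ, true_and] at hi ⊢
      exact fun h => hi (hzero i h)
    · have := hsub (show j ∈ Finset.univ.filter fun i => c i ≠ 0 by simpa using hcj)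
      simp only [Finset.mem_filter, Finset.mem_univ, true_and] at this
      apply this
      simp [hτ, div_mul_cancel₀ _ hj.ne']
  obtain ⟨c', h1, h2, h3, h4⟩ := ih _ hlt (c - τ • d) hc1 rfl
  refine ⟨c', h1, fun i hi => h2 i (hzero i hi), ?_, h4⟩
  rw [h3]
  simp [sub_smul, Finset.sum_sub_distrib, mul_smul, ← Finset.smul_sum, hsum]

/-- A nonnegative combination of finitely many vectors can be rewritten with coefficients that are
bounded by a multiple of its norm, without enlarging the support. -/
theorem exists_bounded_nonneg_combination (b : ι → W) :
    ∃ C : ℝ, 0 ≤ C ∧ ∀ c : ι → ℝ, 0 ≤ c → ∃ c' : ι → ℝ, 0 ≤ c' ∧ (∀ i, c i = 0 → c' i = 0) ∧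
      ∑ i, c' i • b i = ∑ i, c i • b i ∧ ‖c'‖ ≤ C * ‖∑ i, c i • b i‖ := by
  classical
  have key : ∀ s : Finset ι, ∃ C : ℝ, 0 ≤ C ∧
      ((∀ d : ι → ℝ, (∀ i, i ∉ s → d i = 0) → ∑ i, d i • b i = 0 → d = 0) →
        ∀ d : ι → ℝ, (∀ i, i ∉ s → d i = 0) → ‖d‖ ≤ C * ‖∑ i, d i • b i‖) := by
    intro s
    by_cases hs : ∀ d : ι → ℝ, (∀ i, i ∉ s → d i = 0) → ∑ i, d i • b i = 0 → d = 0
    · let S : Submodule ℝ (ι → ℝ) :=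
        { carrier := {d | ∀ i, i ∉ s → d i = 0}
          add_mem' := fun ha hb i hi => by simp [ha i hi, hb i hi]
          zero_mem' := fun i _ => rfl
          smul_mem' := fun r a ha i hi => by simp [ha i hi] }
      let φ : S →ₗ[ℝ] W := (Fintype.linearCombination ℝ b).comp S.subtype
      have hφ : ∀ d : S, φ d = ∑ i, (d : ι → ℝ) i • b i := fun d => by
        simp [φ, Fintype.linearCombination_apply]
      have hker : LinearMap.ker φ = ⊥ := by
        rw [LinearMap.ker_eq_bot']
        intro d hd
        exact Subtype.ext (hs d d.2 (by rw [← hφ]; exact hd))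
      obtain ⟨L, -, hL⟩ := LinearMap.exists_antilipschitzWith φ hker
      refine ⟨L, L.2, fun _ d hd => ?_⟩
      have := hL.le_mul_dist (⟨d, hd⟩ : S) 0
      rw [dist_zero_right, map_zero, dist_zero_right, hφ] at this
      exact this
    -- On a dependent support nothing is claimed, so any constant serves.
    · exact ⟨0, le_rfl, fun h => absurd h hs⟩
  choose C hC0 hC using key
  -- There are finitely many supports, so the sum dominates the constant of whichever independent
  -- support Carathéodory produces.
  refine ⟨∑ s, C s, Finset.sum_nonneg fun s _ => hC0 s, fun c hc => ?_⟩
  obtain ⟨c', h1, h2, h3, h4⟩ := exists_linearIndepOn_nonneg_combination b c hc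
  refine ⟨c', h1, h2, h3, ?_⟩
  rw [← h3]
  refine (hC (Finset.univ.filter fun i => c' i ≠ 0) (fun d hd => h4 d fun i hi => hd i ?_) c'
    fun i hi => ?_).trans
    (mul_le_mul_of_nonneg_right (Finset.single_le_sum (fun s _ => hC0 s) (Finset.mem_univ _))
      (norm_nonneg _))
  · simpa using hi
  · simpa using hi

/-- The coefficients of a convergent sequence can be chosen bounded, hence with a convergent
subsequence. -/
theorem isClosed_range_nonneg_combination (b : ι → W) :
    IsClosed {w | ∃ c : ι → ℝ, 0 ≤ c ∧ ∑ i, c i • b i = w} := by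
  obtain ⟨C, hC0, hC⟩ := exists_bounded_nonneg_combination b
  refine isClosed_of_closure_subset fun w hw => ?_
  obtain ⟨v, hv, hvw⟩ := mem_closure_iff_seq_limit.1 hw
  have : ∀ k, ∃ c : ι → ℝ, 0 ≤ c ∧ ∑ i, c i • b i = v k ∧ ‖c‖ ≤ C * ‖v k‖ := by
    intro k
    obtain ⟨c, hc, hcv⟩ := hv k
    obtain ⟨c', h1, -, h3, h4⟩ := hC c hc
    exact ⟨c', h1, h3.trans hcv, by rwa [hcv] at h4⟩
  choose c hc hcv hcn using this
  obtain ⟨R, hR⟩ := (Metric.isBounded_range_of_tendsto v hvw).exists_norm_le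
  obtain ⟨c₀, -, φ, hφ, hlim⟩ := tendsto_subseq_of_bounded
    (Metric.isBounded_closedBall (x := (0 : ι → ℝ)) (r := C * R)) (x := c) fun k => by
      rw [mem_closedBall_zero_iff]
      exact (hcn k).trans (mul_le_mul_of_nonneg_left (hR _ ⟨k, rfl⟩) hC0)
  refine ⟨c₀, ge_of_tendsto' hlim fun k => hc _, ?_⟩
  refine tendsto_nhds_unique (f := fun k => ∑ i, c (φ k) i • b i) (tendsto_finsetSum _ fun i _ =>
    ((tendsto_pi_nhds.1 hlim i).smul_const _)) ?_
  simp only [hcv]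
  exact hvw.comp hφ.tendsto_atTop

/-- Coefficients converging to `c₀` can be replaced by coefficients with the same image under `A`
whose distance to `c₀` is controlled by the images under `A`. -/
theorem eventually_exists_combination_close {V : Type*} [AddCommGroup V] [Module ℝ V]
    (a : ι → V) (A : V →ₗ[ℝ] W) (c : ℕ → ι → ℝ) (c₀ : ι → ℝ) (hc : ∀ k, 0 ≤ c k)
    (hlim : Tendsto c atTop (𝓝 c₀)) (hA : Tendsto (fun k => A (∑ i, c k i • a i)) atTop
      (𝓝 (A (∑ i, c₀ i • a i)))) :
    ∃ C : ℝ, ∀ᶠ k in atTop, ∃ c' : ι → ℝ, 0 ≤ c' ∧ (∀ i, c k i = 0 → c' i = 0) ∧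
      A (∑ i, c' i • a i) = A (∑ i, c k i • a i) ∧
      ‖c' - c₀‖ ≤ C * ‖A (∑ i, c k i • a i) - A (∑ i, c₀ i • a i)‖ := by
  -- Using both `A (a i)` and `-A (a i)` represents the signed difference `c k - c₀` by its positive
  -- and negative parts. Not enlarging the support then preserves the sign of each correction.
  obtain ⟨C, hC0, hC⟩ := exists_bounded_nonneg_combination
    (Sum.elim (fun i => A (a i)) (fun i => -A (a i)))
  have hc₀ : 0 ≤ c₀ := ge_of_tendsto' hlim hc
  have hsmall : Tendsto (fun k => C * ‖A (∑ i, c k i • a i) - A (∑ i, c₀ i • a i)‖) atTop (𝓝 0) := by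
    simpa using ((hA.sub_const (A (∑ i, c₀ i • a i))).norm).const_mul C
  have hpos : ∀ᶠ k in atTop, ∀ i, 0 < c₀ i → 0 < c k i ∧
      C * ‖A (∑ i, c k i • a i) - A (∑ i, c₀ i • a i)‖ < c₀ i := by
    refine eventually_all.2 fun i => ?_
    by_cases hi : 0 < c₀ i
    · filter_upwards [(tendsto_pi_nhds.1 hlim i).eventually_const_lt hi,
        hsmall.eventually_lt_const hi] with k h1 h2 _ using ⟨h1, h2⟩
    · exact Eventually.of_forall fun k h => absurd h hi
  refine ⟨2 * C, ?_⟩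
  filter_upwards [hpos] with k hk
  set D := A (∑ i, c k i • a i) - A (∑ i, c₀ i • a i) with hD
  obtain ⟨e, he0, hes, hesum, hen⟩ := hC
    (Sum.elim (fun i => max (c k i - c₀ i) 0) (fun i => max (c₀ i - c k i) 0))
    (by rintro (i | i) <;> simp)
  have hsum : ∑ i, (Sum.elim (fun i => max (c k i - c₀ i) 0)
      (fun i => max (c₀ i - c k i) 0) i : ℝ) •
      (Sum.elim (fun i => A (a i)) (fun i => -A (a i)) i : W) = D := by
    rw [Fintype.sum_sum_type, ← Finset.sum_add_distrib, hD, map_sum, map_sum,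
      ← Finset.sum_sub_distrib]
    refine Finset.sum_congr rfl fun i _ => ?_
    simp only [Sum.elim_inl, Sum.elim_inr, map_smul, smul_neg, ← sub_eq_add_neg, ← sub_smul]
    congr 1
    rcases le_total (c k i) (c₀ i) with h | h
    · rw [max_eq_right (by linarith), max_eq_left (by linarith)]; ring
    · rw [max_eq_left (by linarith), max_eq_right (by linarith)]; ring
  rw [hsum] at hesum hen
  have hel : ∀ i, |e i| ≤ C * ‖D‖ := fun i => (norm_le_pi_norm e i).trans hen
  have hinl : ∀ i, c k i ≤ c₀ i → e (Sum.inl i) = 0 := fun i hi =>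
    hes _ (by simpa using hi)
  have hinr : ∀ i, c₀ i ≤ c k i → e (Sum.inr i) = 0 := fun i hi =>
    hes _ (by simpa using hi)
  have hlow : ∀ i, 0 < c₀ i ∨ c₀ i = 0 := fun i => (hc₀ i).lt_or_eq.imp_right Eq.symm
  -- Nonnegativity: where `c₀ i > 0` the correction is eventually smaller than `c₀ i`; where `c₀ i =
  -- 0` there is no downward correction, because `c k i ≥ c₀ i`.
  refine ⟨fun i => c₀ i + e (Sum.inl i) - e (Sum.inr i), fun i => ?_, fun i hi => ?_, ?_, ?_⟩
  · have h1 := he0 (Sum.inl i)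
    simp only [Pi.zero_apply] at h1 ⊢
    rcases hlow i with h | h
    · have := (le_abs_self _).trans (hel (Sum.inr i))
      linarith [(hk i h).2]
    · rw [hinr i (h ▸ hc k i), h]; linarith
  · rcases hlow i with h | h
    · exact absurd hi (hk i h).1.ne'
    · simp only
      rw [hinr i (by rw [h, hi]), hinl i (by rw [h, hi]), h]; simp
  · rw [Fintype.sum_sum_type] at hesum
    simp only [Sum.elim_inl, Sum.elim_inr, smul_neg, Finset.sum_neg_distrib] at hesum
    simp only [add_smul, sub_smul, Finset.sum_add_distrib, Finset.sum_sub_distrib, map_add, map_sub]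
    rw [map_sum A (fun i => e (Sum.inl i) • a i), map_sum A (fun i => e (Sum.inr i) • a i)]
    simp only [map_smul]
    rw [add_sub_assoc, sub_eq_add_neg, hesum, hD]
    abel
  · refine (pi_norm_le_iff_of_nonneg (by positivity)).2 fun i => ?_
    have h1 := hel (Sum.inl i)
    have h2 := hel (Sum.inr i)
    simp only [Pi.sub_apply, Real.norm_eq_abs]
    rw [show c₀ i + e (Sum.inl i) - e (Sum.inr i) - c₀ i = e (Sum.inl i) - e (Sum.inr i) by ring]
    calc _ ≤ |e (Sum.inl i)| + |e (Sum.inr i)| := abs_sub _ _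
      _ ≤ 2 * C * ‖D‖ := by linarith

end Caratheodory

/-! ### Bounded multipliers from the Hahn–Banach theorem. -/

section HahnBanach

open scoped Pointwise

variable {X E : Type*} [NormedAddCommGroup X] [NormedSpace ℝ X]
  [NormedAddCommGroup E] [NormedSpace ℝ E]

theorem infDist_smul_cone (T : PointedCone ℝ E) {c : ℝ} (hc : 0 < c) (y : E) :
    Metric.infDist (c • y) (T : Set E) = c * Metric.infDist y (T : Set E) := by
  have hT : c • (T : Set E) = T := by
    ext w
    rw [Set.mem_smul_set_iff_inv_smul_mem₀ hc.ne']
    constructor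
    · intro h
      simpa [smul_smul, hc.ne'] using T.smul_mem hc.le h
    · intro h
      exact T.smul_mem (inv_pos.2 hc).le h
  conv_lhs => rw [← hT]
  rw [infDist_smul₀ hc.ne', Real.norm_of_nonneg hc.le]

theorem infDist_add_cone (T : PointedCone ℝ E) (x y : E) :
    Metric.infDist (x + y) (T : Set E) ≤
      Metric.infDist x (T : Set E) + Metric.infDist y (T : Set E) := by
  have hne : (T : Set E).Nonempty := ⟨0, T.zero_mem⟩
  refine le_of_forall_pos_le_add fun ε hε => ?_
  obtain ⟨a, ha, hax⟩ := (Metric.infDist_lt_iff hne).1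
    (show Metric.infDist x (T : Set E) < Metric.infDist x (T : Set E) + ε / 2 by linarith)
  obtain ⟨b, hb, hby⟩ := (Metric.infDist_lt_iff hne).1
    (show Metric.infDist y (T : Set E) < Metric.infDist y (T : Set E) + ε / 2 by linarith)
  have := Metric.infDist_le_dist_of_mem (x := x + y) (T.add_mem ha hb)
  linarith [dist_add_add_le x y a b]

/-- A sublinear estimate for `ν` in terms of `A` and a cone `T` yields a bounded multiplier. -/
theorem exists_multiplier_of_le_norm_sub (A : X →L[ℝ] E) (ν : StrongDual ℝ X) {β : ℝ} (hβ : 0 ≤ β)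
    (T : PointedCone ℝ E) (h : ∀ u, ∀ w ∈ T, ν u ≤ β * ‖A u - w‖) :
    ∃ μ : StrongDual ℝ E, ‖μ‖ ≤ β ∧ μ.comp A = ν ∧ ∀ w ∈ T, μ w ≤ 0 := by
  have hker : LinearMap.ker (A : X →ₗ[ℝ] E) ≤ LinearMap.ker (ν : X →ₗ[ℝ] ℝ) := by
    intro u hu
    have hu' : A u = 0 := hu
    have h1 := h u 0 T.zero_mem
    have h2 := h (-u) 0 T.zero_mem
    simp only [map_neg, hu', neg_zero, sub_zero, norm_zero, mul_zero] at h1 h2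
    exact le_antisymm h1 (by simpa using h2)
  -- Since `ν` vanishes on the kernel of `A`, it factors through the range of `A`; `σ` realizes the
  -- factor.
  obtain ⟨σ, hσ⟩ := (A : X →ₗ[ℝ] E).rangeRestrict.exists_rightInverse_of_surjective
    (LinearMap.range_rangeRestrict _)
  have hφ' : ∀ u, ν (σ ⟨A u, u, rfl⟩) = ν u := fun u => by
    have h1 : A (σ ⟨A u, u, rfl⟩) = A u := congrArg Subtype.val
      (LinearMap.congr_fun hσ (⟨A u, u, rfl⟩ : LinearMap.range (A : X →ₗ[ℝ] E)))
    have h2 : σ ⟨A u, u, rfl⟩ - u ∈ LinearMap.ker (ν : X →ₗ[ℝ] ℝ) := hker (by simp [h1])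
    simpa [sub_eq_zero] using h2
  have hne : (T : Set E).Nonempty := ⟨0, T.zero_mem⟩
  -- The majorant `β * dist(·, T)` encodes both conclusions: it is at most `β ‖·‖` and vanishes on
  -- `T`.
  obtain ⟨m, hm, hmN⟩ := exists_extension_of_le_sublinear
    ⟨LinearMap.range (A : X →ₗ[ℝ] E), (ν : X →ₗ[ℝ] ℝ).comp σ⟩
    (fun y => β * Metric.infDist y (T : Set E))
    (fun c hc y => by rw [infDist_smul_cone T hc]; ring)
    (fun x y => by
      rw [← mul_add]
      exact mul_le_mul_of_nonneg_left (infDist_add_cone T x y) hβ)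
    (by
      rintro ⟨_, u, rfl⟩
      change ν (σ ⟨A u, u, rfl⟩) ≤ _
      rw [hφ']
      refine le_of_forall_pos_le_add fun ε hε => ?_
      obtain ⟨w, hw, hlt⟩ := (Metric.infDist_lt_iff hne).1 (show Metric.infDist (A u) (T : Set E) <
        Metric.infDist (A u) (T : Set E) + ε / (β + 1) by
          have : 0 < ε / (β + 1) := by positivity
          linarith)
      rw [dist_eq_norm] at hlt
      refine (h u w hw).trans ((mul_le_mul_of_nonneg_left hlt.le hβ).trans ?_)
      rw [mul_add]
      have : β * (ε / (β + 1)) ≤ ε := by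
        rw [← mul_div_assoc, div_le_iff₀ (by positivity)]
        nlinarith
      exact add_le_add_right this _)
  have hbound : ∀ y, m y ≤ β * ‖y‖ := fun y => (hmN y).trans
    (mul_le_mul_of_nonneg_left (by
      simpa using Metric.infDist_le_dist_of_mem (x := y) (T.zero_mem)) hβ)
  have habs : ∀ y, ‖m y‖ ≤ β * ‖y‖ := fun y => by
    rw [Real.norm_eq_abs, abs_le']
    exact ⟨hbound y, by simpa using hbound (-y)⟩
  refine ⟨m.mkContinuous β habs, m.mkContinuous_norm_le hβ habs, ?_, fun w hw => ?_⟩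
  · ext u
    have := hm ⟨A u, u, rfl⟩
    exact this.trans (hφ' u)
  · have := hmN w
    rw [Metric.infDist_zero_of_mem hw, mul_zero] at this
    exact this

end HahnBanach

/-! ### Joint limits of operators and arguments. -/

section Limits

variable {α F₁ F₂ F₃ : Type*} [NormedAddCommGroup F₁] [NormedSpace ℝ F₁] [NormedAddCommGroup F₂]
  [NormedSpace ℝ F₂] [NormedAddCommGroup F₃] [NormedSpace ℝ F₃] {l : Filter α}

theorem tendsto_clm_apply {φ : α → F₁ →L[ℝ] F₂} {x : α → F₁} {φ₀ : F₁ →L[ℝ] F₂} {x₀ : F₁}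
    (hφ : Tendsto φ l (𝓝 φ₀)) (hx : Tendsto x l (𝓝 x₀)) :
    Tendsto (fun a => φ a (x a)) l (𝓝 (φ₀ x₀)) :=
  (isBoundedBilinearMap_apply.continuous.tendsto (φ₀, x₀)).comp (hφ.prodMk_nhds hx)

theorem tendsto_clm_comp {φ : α → F₂ →L[ℝ] F₃} {ψ : α → F₁ →L[ℝ] F₂} {φ₀ : F₂ →L[ℝ] F₃}
    {ψ₀ : F₁ →L[ℝ] F₂} (hφ : Tendsto φ l (𝓝 φ₀)) (hψ : Tendsto ψ l (𝓝 ψ₀)) :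
    Tendsto (fun a => (φ a).comp (ψ a)) l (𝓝 (φ₀.comp ψ₀)) :=
  (isBoundedBilinearMap_comp.continuous.tendsto (φ₀, ψ₀)).comp (hφ.prodMk_nhds hψ)

end Limits

/-! ### Error bounds, normal cone multipliers and tangent directions. -/

section Multipliers

variable {X E : Type*} [NormedAddCommGroup X] [NormedSpace ℝ X]
  [NormedAddCommGroup E] [InnerProductSpace ℝ E]

/-- The polar cone of `K`, in the dual space. -/
def polar (K : ProperCone ℝ E) : Set (StrongDual ℝ E) :=
  {μ | ∀ e ∈ K, μ e ≤ 0}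

theorem isClosed_polar (K : ProperCone ℝ E) : IsClosed (polar K) := by
  simp only [polar, Set.ofPred_forall]
  exact isClosed_iInter fun e => isClosed_iInter fun _ =>
    isClosed_le (by fun_prop) continuous_const

/-- Near `x` the distance to `Γ` is at most `κ` times the residual of the system `G ∈ K`, uniformly
in perturbed values of `K` near `G x`. -/
def LocalErrorBound (Γ : Set X) (G : X → E) (K : ProperCone ℝ E) (κ : ℝ) (x : X) : Prop :=
  ∀ᶠ q : X × E in 𝓝 (x, G x), q.2 ∈ K → ∀ ε : ℝ, 0 < ε →
    ∃ x' ∈ Γ, ‖x' - q.1‖ ≤ κ * ‖G q.1 - q.2‖ + ε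

variable {Γ : Set X} {G : X → E} {K : ProperCone ℝ E} {κ : ℝ} {x : X} {A : X →L[ℝ] E}

/-- The error bound is applied at `x + t • u` with target `G x + t • (e - s • G x)`, which lies in
`K` for small `t` as a nonnegative combination of `G x` and `e`. Allowing `s` makes all directions
of `K - ℝ₊ G x` available, which later gives complementarity. -/
theorem LocalErrorBound.eventually_exists_mem (hreg : LocalErrorBound Γ G K κ x) (hκ : 0 ≤ κ)
    (hG : HasFDerivAt G A x) (hx : G x ∈ K) {e : E} (he : e ∈ K) (s : ℝ) (u : X)
    {ε : ℝ} (hε : 0 < ε) :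
    ∀ᶠ t in 𝓝[>] (0 : ℝ), ∃ x' ∈ Γ,
      ‖x' - (x + t • u)‖ ≤ t * (κ * ‖A u - (e - s • G x)‖ + ε) := by
  set w := e - s • G x with hw
  have hc1 : Tendsto (fun t : ℝ => (x + t • u, G x + t • w)) (𝓝[>] 0) (𝓝 (x, G x)) := by
    have : Continuous fun t : ℝ => (x + t • u, G x + t • w) := by fun_prop
    simpa using (this.tendsto 0).mono_left nhdsWithin_le_nhds
  have hδ : 0 < ε / (2 * (κ + 1)) := by positivity
  have hd : ∀ᶠ t in 𝓝[>] (0 : ℝ), ‖G (x + t • u) - G x - t • A u‖ ≤ ε / (2 * (κ + 1)) * t := by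
    have h1 : HasDerivAt (fun t : ℝ => G (x + t • u)) (A u) 0 := by
      have h2 : HasDerivAt (fun t : ℝ => x + t • u) u 0 := by
        simpa using ((hasDerivAt_id (0 : ℝ)).smul_const u).const_add x
      have h3 : HasFDerivAt G A (x + (0 : ℝ) • u) := by simpa using hG
      exact h3.comp_hasDerivAt (0 : ℝ) h2
    have := (hasDerivAt_iff_isLittleO.1 h1).def hδ
    filter_upwards [nhdsWithin_le_nhds this, self_mem_nhdsWithin] with t ht ht0
    simpa [abs_of_pos (show (0 : ℝ) < t from ht0)] using ht
  have hs1 : ∀ᶠ t in 𝓝[>] (0 : ℝ), t * s < 1 := by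
    have : Tendsto (fun t : ℝ => t * s) (𝓝[>] 0) (𝓝 0) := by
      simpa using ((continuous_id.mul_const s).tendsto (0 : ℝ)).mono_left nhdsWithin_le_nhds
    exact this.eventually_lt_const one_pos
  filter_upwards [hc1.eventually hreg, hd, hs1, self_mem_nhdsWithin] with t h1 h2 h3 ht
  have ht0 : (0 : ℝ) < t := ht
  have hmem : G x + t • w ∈ K := by
    have : G x + t • w = (1 - t * s) • G x + t • e := by
      rw [hw]; module
    rw [this]
    exact K.add_mem (K.smul_mem hx (by linarith)) (K.smul_mem he ht0.le)
  obtain ⟨x', hx', hb⟩ := h1 hmem (t * (ε / 2)) (by positivity)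
  refine ⟨x', hx', hb.trans ?_⟩
  have h4 : ‖G (x + t • u) - (G x + t • w)‖ ≤ ε / (2 * (κ + 1)) * t + t * ‖A u - w‖ := by
    calc _ = ‖(G (x + t • u) - G x - t • A u) + t • (A u - w)‖ := by congr 1; module
      _ ≤ _ := (norm_add_le _ _).trans (by
        rw [norm_smul, Real.norm_of_nonneg ht0.le]; linarith)
  have h5 : κ * (ε / (2 * (κ + 1))) ≤ ε / 2 := by
    rw [← mul_div_assoc, div_le_div_iff₀ (by positivity) (by positivity)]
    nlinarith
  nlinarith [mul_le_mul_of_nonneg_left h4 hκ, mul_le_mul_of_nonneg_left h5 ht0.le]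

/-- Testing `ν` on feasible points near `x + t • u` gives `ν u ≤ κ ‖ν‖ ‖A u - w‖` for every `w` in
`K - ℝ₊ G x`; Hahn–Banach turns this into a multiplier of norm at most `κ ‖ν‖`. Its sign on `-G x`
is what forces `μ (G x) = 0`. -/
theorem LocalErrorBound.exists_multiplier_of_regularNormal (hreg : LocalErrorBound Γ G K κ x)
    (hκ : 0 ≤ κ) (hG : HasFDerivAt G A x) (hx : G x ∈ K) {ν : StrongDual ℝ X}
    (hν : ν ∈ regularNormalCone Γ x) :
    ∃ μ ∈ polar K, μ (G x) = 0 ∧ μ.comp A = ν ∧ ‖μ‖ ≤ κ * ‖ν‖ := by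
  have key : ∀ u : X, ∀ e ∈ K, ∀ s : ℝ, ν u ≤ κ * ‖ν‖ * ‖A u - (e - s • G x)‖ := by
    intro u e he s
    set a := κ * ‖A u - (e - s • G x)‖ with ha
    have ha0 : 0 ≤ a := by positivity
    have main : ∀ ε : ℝ, 0 < ε → ν u ≤ ε * (a + ε + ‖u‖) + ‖ν‖ * (a + ε) := by
      intro ε hε
      have h1 := hreg.eventually_exists_mem hκ hG hx he s u hε
      obtain ⟨δ, hδ, hball⟩ := Metric.mem_nhdsWithin_iff.1 (hν.2 ε hε)
      have h2 : ∀ᶠ t in 𝓝[>] (0 : ℝ), t * (a + ε + ‖u‖) < δ := by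
        have : Tendsto (fun t : ℝ => t * (a + ε + ‖u‖)) (𝓝[>] 0) (𝓝 0) := by
          simpa using ((continuous_id.mul_const (a + ε + ‖u‖)).tendsto (0 : ℝ)).mono_left
            nhdsWithin_le_nhds
        exact this.eventually_lt_const hδ
      obtain ⟨t, ⟨x', hx', hb⟩, h2, ht⟩ := (h1.and (h2.and self_mem_nhdsWithin)).exists
      have ht0 : (0 : ℝ) < t := ht
      have h3 : ‖x' - x‖ ≤ t * (a + ε + ‖u‖) := by
        calc ‖x' - x‖ = ‖(x' - (x + t • u)) + t • u‖ := by congr 1; module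
          _ ≤ t * (a + ε) + t * ‖u‖ := (norm_add_le _ _).trans (by
            rw [norm_smul, Real.norm_of_nonneg ht0.le]; linarith)
          _ = _ := by ring
      have h4 : ν (x' - x) ≤ ε * ‖x' - x‖ :=
        hball ⟨by rw [Metric.mem_ball, dist_eq_norm]; linarith, hx'⟩
      have h5 : -ν (x' - (x + t • u)) ≤ ‖ν‖ * (t * (a + ε)) :=
        (neg_le_abs _).trans ((ν.le_opNorm _).trans
          (mul_le_mul_of_nonneg_left hb (norm_nonneg _)))
      have h6 : t * ν u = ν (x' - x) - ν (x' - (x + t • u)) := by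
        simp only [map_sub, map_add, map_smul, smul_eq_mul]; ring
      have h7 : ε * ‖x' - x‖ ≤ ε * (t * (a + ε + ‖u‖)) := mul_le_mul_of_nonneg_left h3 hε.le
      refine le_of_mul_le_mul_left ?_ ht0
      linarith
    have hlim : Tendsto (fun ε : ℝ => ε * (a + ε + ‖u‖) + ‖ν‖ * (a + ε)) (𝓝[>] 0)
        (𝓝 (‖ν‖ * a)) := by
      have : Continuous fun ε : ℝ => ε * (a + ε + ‖u‖) + ‖ν‖ * (a + ε) := by fun_prop
      simpa using (this.tendsto 0).mono_left nhdsWithin_le_nhds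
    have := ge_of_tendsto hlim (by
      filter_upwards [self_mem_nhdsWithin] with ε hε using main ε hε)
    rw [ha] at this
    linarith
  obtain ⟨μ, h1, h2, h3⟩ := exists_multiplier_of_le_norm_sub A ν
    (mul_nonneg hκ (norm_nonneg ν)) (K.toPointedCone ⊔ PointedCone.hull ℝ {-G x}) (by
      intro u w hw
      obtain ⟨e, he, y, hy, rfl⟩ := Submodule.mem_sup.1 hw
      obtain ⟨s, rfl⟩ := Submodule.mem_span_singleton.1 hy
      rw [smul_neg, ← sub_eq_add_neg]
      exact key u e he s)
  refine ⟨μ, fun e he => h3 e (Submodule.mem_sup_left he), le_antisymm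
    (h3 _ (Submodule.mem_sup_left hx)) ?_, h2, h1⟩
  have := h3 _ (Submodule.mem_sup_right (Submodule.mem_span_singleton_self (-G x)))
  simpa using this

omit [NormedSpace ℝ X] in
theorem LocalErrorBound.eventually (hreg : LocalErrorBound Γ G K κ x) (hG : ContinuousAt G x) :
    ∀ᶠ x' in 𝓝 x, LocalErrorBound Γ G K κ x' :=
  (continuousAt_id.prodMk hG).eventually (eventually_eventually_nhds.2 hreg)

/-- The error bound persists at nearby points with the same `κ`, so the multipliers of approximating
regular normals are bounded and cluster. -/
theorem LocalErrorBound.exists_multiplier [FiniteDimensional ℝ E]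
    (hreg : LocalErrorBound Γ G K κ x) (hκ : 0 ≤ κ) (hG : ContDiffAt ℝ 1 G x)
    (hΓ : ∀ᶠ x' in 𝓝 x, x' ∈ Γ → G x' ∈ K) {ν : StrongDual ℝ X} (hν : ν ∈ normalCone Γ x) :
    ∃ μ ∈ polar K, μ (G x) = 0 ∧ μ.comp (fderiv ℝ G x) = ν ∧ ‖μ‖ ≤ κ * ‖ν‖ := by
  obtain ⟨-, w, ws, hw, hwΓ, hwn, hws⟩ := hν
  have hdiff : ∀ᶠ x' in 𝓝 x, DifferentiableAt ℝ G x' := by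
    filter_upwards [hG.eventually (by simp)] with x' h using h.differentiableAt (by simp)
  have hfd : ContinuousAt (fderiv ℝ G) x :=
    (hG.fderiv_right (m := 0) (by norm_num)).continuousAt
  have hev := hw.eventually ((hreg.eventually hG.continuousAt).and (hdiff.and hΓ))
  obtain ⟨N, hN⟩ := eventually_atTop.1 hev
  have : ∀ k, ∃ μ ∈ polar K, μ (G (w (k + N))) = 0 ∧ μ.comp (fderiv ℝ G (w (k + N))) = ws (k + N) ∧
      ‖μ‖ ≤ κ * ‖ws (k + N)‖ := fun k => by
    obtain ⟨h1, h2, h3⟩ := hN (k + N) (by omega)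
    exact h1.exists_multiplier_of_regularNormal hκ h2.hasFDerivAt (h3 (hwΓ _)) (hwn _)
  choose μ hμK hμ0 hμc hμn using this
  replace hw := (tendsto_add_atTop_iff_nat N).2 hw
  replace hws := (tendsto_add_atTop_iff_nat N).2 hws
  obtain ⟨R, hR⟩ := (Metric.isBounded_range_of_tendsto _ hws).exists_norm_le
  obtain ⟨μ₀, -, φ, hφ, hlim⟩ := tendsto_subseq_of_bounded
    (Metric.isBounded_closedBall (x := (0 : StrongDual ℝ E)) (r := κ * R)) (x := μ) fun k => by
      rw [mem_closedBall_zero_iff]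
      exact (hμn k).trans (mul_le_mul_of_nonneg_left (hR _ ⟨k, rfl⟩) hκ)
  replace hw := hw.comp hφ.tendsto_atTop
  replace hws := hws.comp hφ.tendsto_atTop
  refine ⟨μ₀, (isClosed_polar K).mem_of_tendsto hlim (Eventually.of_forall fun k => hμK _),
    ?_, ?_, ?_⟩
  · refine tendsto_nhds_unique (tendsto_clm_apply hlim (hG.continuousAt.tendsto.comp hw)) ?_
    refine tendsto_const_nhds.congr fun k => ?_
    simp [hμ0]
  · refine tendsto_nhds_unique (tendsto_clm_comp hlim (hfd.tendsto.comp hw)) ?_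
    refine hws.congr fun k => ?_
    simp [hμc]
  · exact le_of_tendsto_of_tendsto' hlim.norm (hws.norm.const_mul κ) fun k => hμn _

/-- With the target direction `e = A u` the linearized residual vanishes, so feasible points lie
within `o(t)` of `x + t • u`. -/
theorem LocalErrorBound.mem_posTangentConeAt (hreg : LocalErrorBound Γ G K κ x) (hκ : 0 ≤ κ)
    (hG : HasFDerivAt G A x) (hx : G x ∈ K) {u : X} (hu : A u ∈ K) :
    u ∈ posTangentConeAt Γ x := by
  have key : ∀ n : ℕ, ∃ t : ℝ, 0 < t ∧ t < 1 / ((n : ℝ) + 1) ∧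
      ∃ x' ∈ Γ, ‖x' - (x + t • u)‖ ≤ t * (1 / ((n : ℝ) + 1)) := by
    intro n
    have hn : (0 : ℝ) < 1 / ((n : ℝ) + 1) := by positivity
    have h1 := hreg.eventually_exists_mem hκ hG hx hu 0 u hn
    obtain ⟨t, ⟨x', hx', hb⟩, h2, ht⟩ :=
      (h1.and ((eventually_nhdsWithin_of_eventually_nhds (eventually_lt_nhds hn)).and
        self_mem_nhdsWithin)).exists
    exact ⟨t, ht, h2, x', hx', by simpa using hb⟩
  choose t ht0 ht x' hx' hb using key
  have htl : Tendsto t atTop (𝓝 0) := squeeze_zero (fun n => (ht0 n).le) (fun n => (ht n).le)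
    tendsto_one_div_add_atTop_nhds_zero_nat
  have hdiff : Tendsto (fun n => (t n)⁻¹ • (x' n - x)) atTop (𝓝 u) := by
    rw [tendsto_iff_norm_sub_tendsto_zero]
    refine squeeze_zero (fun n => norm_nonneg _) (fun n => ?_)
      tendsto_one_div_add_atTop_nhds_zero_nat
    have : (t n)⁻¹ • (x' n - x) - u = (t n)⁻¹ • (x' n - (x + t n • u)) := by
      rw [← sub_sub, smul_sub _ (x' n - x), smul_smul, inv_mul_cancel₀ (ht0 n).ne', one_smul]
    rw [this, norm_smul, norm_inv, Real.norm_of_nonneg (ht0 n).le, inv_mul_le_iff₀ (ht0 n)]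
    exact hb n
  refine mem_tangentConeAt_of_seq atTop (fun n => (⟨(t n)⁻¹, (inv_pos.2 (ht0 n)).le⟩ : ℝ≥0))
    (fun n => x' n - x) ?_ (Eventually.of_forall fun n => by simpa using hx' n) hdiff
  have := htl.smul hdiff
  rw [zero_smul] at this
  exact this.congr fun n => by rw [smul_smul, mul_inv_cancel₀ (ht0 n).ne', one_smul]

theorem map_mem_of_mem_posTangentConeAt (hG : HasFDerivAt G A x) (hx : G x = 0)
    (hΓ : ∀ᶠ x' in 𝓝 x, x' ∈ Γ → G x' ∈ K) {u : X} (hu : u ∈ posTangentConeAt Γ x) : A u ∈ K := by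
  obtain ⟨c, d, hd, hds, hcd⟩ := mem_tangentConeAt_iff_exists_seq.1 hu
  have hxd : Tendsto (fun n => x + d n) atTop (𝓝 x) := by simpa using hd.const_add x
  have hlim : Tendsto (fun n => (c n : ℝ) • (G (x + d n) - G x)) atTop (𝓝 (A u)) :=
    (hasFDerivWithinAt_univ.2 hG).lim (c := fun n => (c n : ℝ)) hd
      (Eventually.of_forall fun _ => Set.mem_univ _) hcd
  refine K.isClosed.mem_of_tendsto hlim ?_
  filter_upwards [hxd.eventually hΓ, hds] with n h1 h2
  rw [hx, sub_zero]
  exact K.smul_mem (h1 h2) (c n).2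

end Multipliers

/-! ### Prolongation of segments through relative interior points. -/

section RelativeInterior

theorem exists_add_smul_sub_mem_of_mem_intrinsicInterior {V : Type*} [NormedAddCommGroup V]
    [NormedSpace ℝ V] {s : Set V} {x y : V} (hx : x ∈ intrinsicInterior ℝ s) (hy : y ∈ s) :
    ∃ ε : ℝ, 0 < ε ∧ x + ε • (x - y) ∈ s := by
  obtain ⟨x', hx', rfl⟩ := hx
  let γ : ℝ → affineSpan ℝ s := fun t =>
    ⟨AffineMap.lineMap (x' : V) y t, AffineMap.lineMap_mem t x'.2 (subset_affineSpan ℝ s hy)⟩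
  have hγ : Continuous γ := Continuous.subtype_mk AffineMap.lineMap_continuous _
  have hγ0 : γ 0 = x' := Subtype.ext (by simp [γ])
  have hev : ∀ᶠ t in 𝓝 (0 : ℝ), γ t ∈ ((↑) ⁻¹' s : Set (affineSpan ℝ s)) :=
    hγ.continuousAt.eventually (by rw [hγ0]; exact mem_interior_iff_mem_nhds.1 hx')
  have hneg : Tendsto (fun t : ℝ => -t) (𝓝[>] 0) (𝓝 0) := by
    simpa using (continuous_neg.tendsto (0 : ℝ)).mono_left nhdsWithin_le_nhds
  obtain ⟨t, ht, ht0⟩ := ((hneg.eventually hev).and self_mem_nhdsWithin).exists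
  refine ⟨t, ht0, ?_⟩
  have : (γ (-t) : V) = x' + t • ((x' : V) - y) := by
    simp only [γ, AffineMap.lineMap_apply_module']
    module
  rw [← this]
  exact ht

end RelativeInterior

/-! ### Bipolar theorem and finite generation of polars of polyhedral cones. -/

section Polar

variable {E : Type*} [NormedAddCommGroup E] [InnerProductSpace ℝ E]

theorem mem_of_forall_polar [CompleteSpace E] (K : ProperCone ℝ E) {e : E}
    (he : ∀ μ ∈ polar K, μ e ≤ 0) : e ∈ K := by
  by_contra hne
  obtain ⟨φ, hφ, hφe⟩ := K.hyperplane_separation_point hne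
  have := he (-φ) fun e' he' => by simpa using hφ e' he'
  simp only [neg_apply] at this
  linarith

/-- Farkas' lemma: the cone generated by the defining vectors is closed, and a vector separating
`-m` from it would lie in `K` and violate `μ ∈ polar K`. -/
theorem IsPolyhedral.exists_polar_eq [FiniteDimensional ℝ E] {K : ProperCone ℝ E}
    (hK : IsPolyhedral K) : ∃ (s : Finset E) (a : s → StrongDual ℝ E), (∀ i, a i ∈ polar K) ∧
      ∀ μ ∈ polar K, ∃ c : s → ℝ, 0 ≤ c ∧ ∑ i, c i • a i = μ := by
  obtain ⟨s, hs⟩ := hK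
  have hmem : ∀ e : E, e ∈ K ↔ ∀ i : s, 0 ≤ inner ℝ (i : E) e := fun e => by
    have : e ∈ K ↔ e ∈ K.toPointedCone := Iff.rfl
    rw [this, ← hs]
    simp
  refine ⟨s, fun i => -innerSL ℝ (i : E), fun i e he => by simpa using (hmem e).1 he i,
    fun μ hμ => ?_⟩
  let Q : ProperCone ℝ E :=
    { carrier := {w | ∃ c : s → ℝ, 0 ≤ c ∧ ∑ i, c i • (i : E) = w}
      add_mem' := by
        rintro _ _ ⟨c, hc, rfl⟩ ⟨d, hd, rfl⟩
        exact ⟨c + d, add_nonneg hc hd, by simp [add_smul, Finset.sum_add_distrib]⟩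
      zero_mem' := ⟨0, le_rfl, by simp⟩
      smul_mem' := by
        rintro ⟨r, hr⟩ _ ⟨c, hc, rfl⟩
        refine ⟨r • c, smul_nonneg hr hc, ?_⟩
        simp only [Pi.smul_apply, smul_eq_mul, mul_smul, ← Finset.smul_sum]
        rfl
      isClosed' := isClosed_range_nonneg_combination _ }
  set m := (InnerProductSpace.toDual ℝ E).symm μ with hm
  have hmμ : ∀ e, inner ℝ m e = μ e := fun e => by simp [hm]
  have hQ : -m ∈ Q := by
    by_contra hne
    classical
    obtain ⟨y, hy, hy0⟩ := ProperCone.hyperplane_separation' Q hne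
    have hyK : y ∈ K := (hmem y).2 fun i => hy _ ⟨Pi.single i 1, by
      intro j
      by_cases h : j = i
      · subst h; simp
      · simp [h], by
        rw [Finset.sum_eq_single i (fun j _ hj => by simp [hj]) (by simp)]
        simp⟩
    have := hμ y hyK
    rw [inner_neg_left, hmμ] at hy0
    linarith
  obtain ⟨c, hc, hcm⟩ := hQ
  refine ⟨c, hc, ?_⟩
  ext e
  have h1 : inner ℝ (∑ i, c i • (i : E)) e = inner ℝ (-m) e := by rw [hcm]
  rw [inner_neg_left, hmμ, sum_inner] at h1
  simp only [sum_apply, smul_apply,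
    neg_apply, innerSL_apply_apply, smul_eq_mul, mul_neg,
    Finset.sum_neg_distrib]
  simp only [inner_smul_left, RCLike.conj_to_real] at h1
  rw [h1, neg_neg]

end Polar

/-! ### Error bound and normal cone of a cone-reducible set. -/

section Reduction

variable {Y E : Type*} [NormedAddCommGroup Y] [InnerProductSpace ℝ Y]
  [NormedAddCommGroup E] [InnerProductSpace ℝ E] {C : Set Y} {y : Y} {K : ProperCone ℝ E}
  {h : Y → E}

theorem IsConeReduction.contDiffAt (hred : IsConeReduction C y K h) : ContDiffAt ℝ 2 h y := by
  obtain ⟨V, hV, hy, hh, -⟩ := hred.exists_nhd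
  exact hh.contDiffAt (hV.mem_nhds hy)

theorem IsConeReduction.eventually_mem_iff (hred : IsConeReduction C y K h) :
    ∀ᶠ y' in 𝓝 y, y' ∈ C ↔ h y' ∈ K := by
  obtain ⟨V, hV, hy, -, hCV⟩ := hred.exists_nhd
  filter_upwards [hV.mem_nhds hy] with y' hy'
  have := Set.ext_iff.1 hCV y'
  simpa [hy'] using this

/-- Lyusternik–Graves: as `∇h(y)` is onto, every value near `h y` is attained at a point whose
distance is linear in the residual, and points with value in `K` belong to `C`. -/
theorem IsConeReduction.exists_localErrorBound [FiniteDimensional ℝ Y] [FiniteDimensional ℝ E]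
    (hred : IsConeReduction C y K h) : ∃ κ : ℝ, 0 ≤ κ ∧ LocalErrorBound C h K κ y := by
  have hstrict : HasStrictFDerivAt h (fderiv ℝ h y) y :=
    hred.contDiffAt.hasStrictFDerivAt (by simp)
  have hsurj : (fderiv ℝ h y).range = ⊤ := LinearMap.range_eq_top.2 hred.surjective
  let R := (fderiv ℝ h y).nonlinearRightInverseOfSurjective hsurj
  have hR : 0 < R.nnnorm := (fderiv ℝ h y).nonlinearRightInverseOfSurjective_nnnorm_pos hsurj
  -- Half of the openness rate is spent on nonlinearity; the other half gives the modulus `2 *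
  -- R.nnnorm`.
  obtain ⟨s, hs, happ⟩ := hstrict.approximates_deriv_on_nhds
    (c := R.nnnorm⁻¹ / 2) (Or.inr (by positivity))
  obtain ⟨r, hr, hball⟩ := Metric.mem_nhds_iff.1 (inter_mem hs hred.eventually_mem_iff)
  have hN : (0 : ℝ) < R.nnnorm := hR
  refine ⟨2 * R.nnnorm, by positivity, ?_⟩
  have hlim : Tendsto (fun q : Y × E => dist q.1 y + 2 * R.nnnorm * ‖h q.1 - q.2‖)
      (𝓝 (y, h y)) (𝓝 0) := by
    have : ContinuousAt (fun q : Y × E => dist q.1 y + 2 * R.nnnorm * ‖h q.1 - q.2‖) (y, h y) := by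
      have h1 : ContinuousAt (fun q : Y × E => h q.1) (y, h y) :=
        ContinuousAt.comp (f := Prod.fst) (g := h) (x := (y, h y))
          hred.contDiffAt.continuousAt continuousAt_fst
      exact (continuousAt_fst.dist continuousAt_const).add
        ((h1.sub continuousAt_snd).norm.const_mul _)
    simpa [ContinuousAt] using this
  filter_upwards [hlim.eventually_lt_const hr] with q hq hqK ε hε
  set δ := 2 * R.nnnorm * ‖h q.1 - q.2‖ with hδ
  have hδ0 : 0 ≤ δ := by positivity
  have hsub : Metric.closedBall q.1 δ ⊆ Metric.ball y r := fun w hw => by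
    rw [Metric.mem_closedBall] at hw
    rw [Metric.mem_ball]
    linarith [dist_triangle w q.1 y]
  obtain ⟨y', hy', hyq⟩ := happ.surjOn_closedBall_of_nonlinearRightInverse R hδ0
    (fun w hw => (hball (hsub hw)).1) (show q.2 ∈ _ by
      rw [Metric.mem_closedBall, dist_comm, dist_eq_norm, hδ]
      have : (((R.nnnorm : ℝ)⁻¹ - ((R.nnnorm⁻¹ / 2 : ℝ≥0) : ℝ)) *
          (2 * R.nnnorm * ‖h q.1 - q.2‖)) = ‖h q.1 - q.2‖ := by
        push_cast
        field_simp
        ring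
      rw [this])
  refine ⟨y', (hball (hsub hy')).2.2 (by rw [hyq]; exact hqK), ?_⟩
  rw [Metric.mem_closedBall, dist_eq_norm] at hy'
  linarith

/-- The error bound gives the multiplier; conversely `μ ∘ ∇h(y)` is even a regular normal, because
`μ (h w) ≤ 0 = μ (h y)` for `w` in `C` near `y`. -/
theorem IsConeReduction.mem_normalCone_iff [FiniteDimensional ℝ Y] [FiniteDimensional ℝ E]
    (hred : IsConeReduction C y K h) {l : StrongDual ℝ Y} :
    l ∈ normalCone C y ↔ ∃ μ ∈ polar K, μ.comp (fderiv ℝ h y) = l := by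
  constructor
  · intro hl
    obtain ⟨κ, hκ, hreg⟩ := hred.exists_localErrorBound
    obtain ⟨μ, h1, -, h3, -⟩ := hreg.exists_multiplier hκ (hred.contDiffAt.of_le (by norm_num))
      (hred.eventually_mem_iff.mono fun _ h => h.1) hl
    exact ⟨μ, h1, h3⟩
  · rintro ⟨μ, hμ, rfl⟩
    refine ⟨hred.mem, fun _ => y, fun _ => μ.comp (fderiv ℝ h y), tendsto_const_nhds,
      fun _ => hred.mem, fun _ => ⟨hred.mem, fun ε hε => ?_⟩, tendsto_const_nhds⟩
    have hd : HasFDerivAt (fun w => μ (h w)) (μ.comp (fderiv ℝ h y)) y :=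
      μ.hasFDerivAt.comp y (hred.contDiffAt.differentiableAt (by simp)).hasFDerivAt
    have h1 := (hasFDerivAt_iff_isLittleO.1 hd).def hε
    filter_upwards [nhdsWithin_le_nhds h1, nhdsWithin_le_nhds hred.eventually_mem_iff,
      self_mem_nhdsWithin] with w h2 h3 h4
    have h5 : μ (h w) ≤ 0 := hμ _ (h3.1 h4)
    rw [hred.map_eq_zero, map_zero, sub_zero, Real.norm_eq_abs] at h2
    linarith [neg_abs_le (μ (h w) - (μ.comp (fderiv ℝ h y)) (w - y))]

end Reduction

/-! ### From Robinson stability to a uniform error bound for `h ∘ g`. -/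

section Parametric

variable {P X Y E : Type*}
  [NormedAddCommGroup P] [NormedAddCommGroup X]
  [NormedAddCommGroup Y] [InnerProductSpace ℝ Y] [FiniteDimensional ℝ Y]
  [NormedAddCommGroup E] [InnerProductSpace ℝ E] [FiniteDimensional ℝ E]
  {g : P × X → Y} {C : Set Y} {K : ProperCone ℝ E} {h : Y → E} {z : P × X}

/-- Two error bounds are composed: the residual of `h ∘ g` controls the distance of `g` to `C`,
which controls the distance of `x` to the feasible set. The modulus is the product, the same for all
points near `z`. -/
theorem RobinsonStable.exists_localErrorBound (hRS : RobinsonStable g C z)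
    (hg : ContinuousAt g z) (hred : IsConeReduction C (g z) K h) :
    ∃ κ : ℝ, 0 ≤ κ ∧ ∀ᶠ z' in 𝓝 z,
      LocalErrorBound (feasible g C z'.1) (fun x => h (g (z'.1, x))) K κ z'.2 := by
  obtain ⟨κ, W, hW, U, hU, hdist⟩ := hRS
  obtain ⟨κ₁, hκ₁, hreg⟩ := hred.exists_localErrorBound
  have hhg : ContinuousAt (fun z' => h (g z')) z :=
    ContinuousAt.comp (f := g) (g := h) hred.contDiffAt.continuousAt hg
  refine ⟨κ * κ₁, by positivity, ?_⟩
  have key : ∀ᶠ q : (P × X) × E in 𝓝 (z, h (g z)), q.2 ∈ K → ∀ ε : ℝ, 0 < ε →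
      ∃ x' ∈ feasible g C q.1.1, ‖x' - q.1.2‖ ≤ κ * κ₁ * ‖h (g q.1) - q.2‖ + ε := by
    have h1 : Tendsto (fun q : (P × X) × E => (g q.1, q.2)) (𝓝 (z, h (g z)))
        (𝓝 (g z, h (g z))) :=
      (hg.tendsto.comp (continuous_fst.tendsto (z, h (g z)))).prodMk_nhds
        (continuous_snd.tendsto (z, h (g z)))
    have h2 : ∀ᶠ q : (P × X) × E in 𝓝 (z, h (g z)), q.1.1 ∈ W ∧ q.1.2 ∈ U := by
      have : ∀ᶠ z' in 𝓝 z, z'.1 ∈ W ∧ z'.2 ∈ U :=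
        (continuous_fst.continuousAt.eventually hW).and (continuous_snd.continuousAt.eventually hU)
      exact (continuous_fst.tendsto (z, h (g z))).eventually this
    filter_upwards [h1.eventually hreg, h2] with q hq hWU hqK ε hε
    obtain ⟨y', hy', hb⟩ := hq hqK (ε / (2 * (κ + 1))) (by positivity)
    set r := κ₁ * ‖h (g q.1) - q.2‖ + ε / (2 * (κ + 1)) with hr
    have h3 : Metric.infEDist q.1.2 (feasible g C q.1.1) ≤ ENNReal.ofReal (κ * r) := by
      refine (hdist _ hWU.1 _ hWU.2).trans ?_
      rw [ENNReal.ofReal_mul κ.coe_nonneg, ENNReal.ofReal_coe_nnreal]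
      gcongr
      refine (Metric.infEDist_le_edist_of_mem hy').trans ?_
      rw [edist_comm, edist_dist, dist_eq_norm]
      exact ENNReal.ofReal_le_ofReal hb
    have h4 : κ * r < κ * κ₁ * ‖h (g q.1) - q.2‖ + ε := by
      have : (κ : ℝ) * (ε / (2 * (κ + 1))) < ε := by
        rw [← mul_div_assoc, div_lt_iff₀ (by positivity)]
        nlinarith [κ.coe_nonneg]
      rw [hr]; linarith
    obtain ⟨x', hx', hlt⟩ := Metric.infEDist_lt_iff.1
      (h3.trans_lt ((ENNReal.ofReal_lt_ofReal_iff (by positivity)).2 h4))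
    refine ⟨x', hx', ?_⟩
    rw [edist_comm, edist_dist, dist_eq_norm, ENNReal.ofReal_lt_ofReal_iff (by positivity)] at hlt
    exact hlt.le
  have hpair : Tendsto (fun z' => (z', h (g z'))) (𝓝 z) (𝓝 (z, h (g z))) :=
    tendsto_id.prodMk_nhds hhg
  filter_upwards [hpair.eventually (eventually_eventually_nhds.2 key)] with z' hz'
  have hc : Continuous fun q : X × E => ((z'.1, q.1), q.2) := by fun_prop
  exact (hc.tendsto (z'.2, h (g z'))).eventually hz'

end Parametric

/-! ### Second-order chain rule and Taylor expansion. -/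

section SecondOrder

variable {Z Y E : Type*} [NormedAddCommGroup Z] [NormedSpace ℝ Z] [NormedAddCommGroup Y]
  [NormedSpace ℝ Y] [NormedAddCommGroup E] [NormedSpace ℝ E]

theorem differentiableAt_fderiv_of_contDiffAt_two {G : Z → E} {z : Z} (hG : ContDiffAt ℝ 2 G z) :
    DifferentiableAt ℝ (fderiv ℝ G) z :=
  (hG.fderiv_right (m := 1) (by norm_num)).differentiableAt (by simp)

theorem fderiv_fderiv_comp {g : Z → Y} {h : Y → E} {z : Z} (hh : ContDiffAt ℝ 2 h (g z))
    (hg : ContDiffAt ℝ 2 g z) (v w : Z) :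
    fderiv ℝ (fderiv ℝ (h ∘ g)) z v w =
      fderiv ℝ (fderiv ℝ h) (g z) (fderiv ℝ g z v) (fderiv ℝ g z w) +
        fderiv ℝ h (g z) (fderiv ℝ (fderiv ℝ g) z v w) := by
  have hev : fderiv ℝ (h ∘ g) =ᶠ[𝓝 z] fun z' => (fderiv ℝ h (g z')).comp (fderiv ℝ g z') := by
    filter_upwards [hg.eventually (by simp),
      hg.continuousAt.eventually (hh.eventually (by simp))] with z' h1 h2
    exact fderiv_comp z' (h2.differentiableAt (by simp)) (h1.differentiableAt (by simp))
  have h1 : HasFDerivAt (fun z' => fderiv ℝ h (g z'))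
      ((fderiv ℝ (fderiv ℝ h) (g z)).comp (fderiv ℝ g z)) z :=
    (differentiableAt_fderiv_of_contDiffAt_two hh).hasFDerivAt.comp z
      (hg.differentiableAt (by simp)).hasFDerivAt
  have h2 := (differentiableAt_fderiv_of_contDiffAt_two hg).hasFDerivAt
  rw [hev.fderiv_eq, (h1.clm_comp h2).fderiv]
  simp [add_comm]

theorem fderiv_fderiv_clm_comp (l : Y →L[ℝ] E) {g : Z → Y} {z : Z} (hg : ContDiffAt ℝ 2 g z)
    (v w : Z) :
    fderiv ℝ (fderiv ℝ (fun z' => l (g z'))) z v w = l (fderiv ℝ (fderiv ℝ g) z v w) := by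
  have hl : fderiv ℝ (l : Y → E) = fun _ => l := by ext1 y; exact l.fderiv
  have := fderiv_fderiv_comp (h := l) l.contDiff.contDiffAt hg v w
  rw [hl] at this
  simpa [Function.comp_def] using this

/-- Mean value inequality for `G` minus its quadratic model, whose derivative is `o(‖z' - z‖)`;
symmetry of the second derivative is needed to differentiate the model. -/
theorem taylor_two_isLittleO {G : Z → E} {z : Z} (hG : ContDiffAt ℝ 2 G z) :
    (fun z' => G z' - G z - fderiv ℝ G z (z' - z) -
      (2⁻¹ : ℝ) • fderiv ℝ (fderiv ℝ G) z (z' - z) (z' - z)) =o[𝓝 z] fun z' => ‖z' - z‖ ^ 2 := by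
  set B := fderiv ℝ (fderiv ℝ G) z with hB
  have hsymm : ∀ v w, B v w = B w v := hG.isSymmSndFDerivAt (by simp)
  have hd : ∀ z', HasFDerivAt (fun z' => fderiv ℝ G z (z' - z) +
      (2⁻¹ : ℝ) • B (z' - z) (z' - z)) (fderiv ℝ G z + B (z' - z)) z' := by
    intro z'
    have h0 : HasFDerivAt (fun z' => z' - z) (ContinuousLinearMap.id ℝ Z) z' :=
      (hasFDerivAt_id z').sub_const z
    have h1 : HasFDerivAt (fun z' => B (z' - z)) B z' := B.hasFDerivAt.comp z' h0
    refine (((fderiv ℝ G z).hasFDerivAt.comp z' h0).add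
      ((h1.clm_apply h0).const_smul (2⁻¹ : ℝ))).congr_fderiv ?_
    ext w
    simp only [ContinuousLinearMap.comp_id, add_apply, smul_apply, ContinuousLinearMap.flip_apply,
      add_right_inj]
    rw [hsymm w, ← two_smul ℝ, smul_smul]
    norm_num
  refine Asymptotics.isLittleO_iff.2 fun ε hε => ?_
  have h1 := (hasFDerivAt_iff_isLittleO.1
    (differentiableAt_fderiv_of_contDiffAt_two hG).hasFDerivAt).def hε
  obtain ⟨r, hr, hball⟩ := Metric.eventually_nhds_iff_ball.1
    (h1.and (hG.eventually (by simp)))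
  filter_upwards [Metric.ball_mem_nhds z hr] with z' hz'
  have hsub : Metric.closedBall z ‖z' - z‖ ⊆ Metric.ball z r := fun w hw => by
    rw [Metric.mem_ball, dist_eq_norm] at hz' ⊢
    rw [Metric.mem_closedBall, dist_eq_norm] at hw
    linarith
  have := (convex_closedBall z ‖z' - z‖).norm_image_sub_le_of_norm_hasFDerivWithin_le
    (f := fun w => G w - (fderiv ℝ G z (w - z) + (2⁻¹ : ℝ) • B (w - z) (w - z)))
    (f' := fun w => fderiv ℝ G w - (fderiv ℝ G z + B (w - z))) (C := ε * ‖z' - z‖)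
    (fun w hw => (((hball w (hsub hw)).2.differentiableAt (by simp)).hasFDerivAt.sub
      (hd w)).hasFDerivWithinAt)
    (fun w hw => by
      rw [← sub_sub]
      refine (hball w (hsub hw)).1.trans ?_
      rw [Metric.mem_closedBall, dist_eq_norm] at hw
      gcongr)
    (show z ∈ _ by simp) (show z' ∈ _ by simp [dist_eq_norm])
  simp only [sub_self, map_zero, smul_zero, add_zero, sub_zero] at this
  rw [norm_pow, norm_norm]
  calc _ = ‖G z' - (fderiv ℝ G z (z' - z) + (2⁻¹ : ℝ) • B (z' - z) (z' - z)) - G z‖ := by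
        congr 1; abel
    _ ≤ _ := this.trans_eq (by ring)

theorem tendsto_smul_sub_of_hasFDerivAt {G : Z → E} {z : Z} {A : Z →L[ℝ] E}
    (hG : HasFDerivAt G A z) {t : ℕ → ℝ} (ht : ∀ k, 0 < t k) (ht0 : Tendsto t atTop (𝓝 0))
    {v : ℕ → Z} {v₀ : Z} (hv : Tendsto v atTop (𝓝 v₀)) :
    Tendsto (fun k => (t k)⁻¹ • (G (z + t k • v k) - G z)) atTop (𝓝 (A v₀)) := by
  refine (hasFDerivWithinAt_univ.2 hG).lim (c := fun k => (t k)⁻¹) (d := fun k => t k • v k) ?_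
    (Eventually.of_forall fun _ => Set.mem_univ _) ?_
  · simpa using ht0.smul hv
  · exact hv.congr fun k => by rw [smul_smul, inv_mul_cancel₀ (ht k).ne', one_smul]

theorem tendsto_second_difference {G : Z → E} {z : Z} (hG : ContDiffAt ℝ 2 G z) {t : ℕ → ℝ}
    (ht : ∀ k, 0 < t k) (ht0 : Tendsto t atTop (𝓝 0)) {v : ℕ → Z} {v₀ : Z}
    (hv : Tendsto v atTop (𝓝 v₀)) :
    Tendsto (fun k => ((t k) ^ 2)⁻¹ • (G (z + t k • v k) - G z) - (t k)⁻¹ • fderiv ℝ G z (v k))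
      atTop (𝓝 ((2⁻¹ : ℝ) • fderiv ℝ (fderiv ℝ G) z v₀ v₀)) := by
  set B := fderiv ℝ (fderiv ℝ G) z with hB
  have hz : Tendsto (fun k => z + t k • v k) atTop (𝓝 z) := by
    simpa using (ht0.smul hv).const_add z
  have h1 := (taylor_two_isLittleO hG).comp_tendsto hz
  simp only [Function.comp_def, add_sub_cancel_left, ← hB] at h1
  have h2 : (fun k => ‖t k • v k‖ ^ 2) =O[atTop] fun k => t k ^ 2 := by
    have h3 : (fun k => t k • v k) =O[atTop] fun k => t k := by
      simpa using (Asymptotics.isBigO_refl t atTop).smul (hv.isBigO_one ℝ)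
    exact h3.norm_left.pow 2
  have h4 := (h1.trans_isBigO h2).tendsto_inv_smul_nhds_zero
  have h5 : Tendsto (fun k => (2⁻¹ : ℝ) • B (v k) (v k)) atTop (𝓝 ((2⁻¹ : ℝ) • B v₀ v₀)) :=
    (tendsto_clm_apply (tendsto_clm_apply tendsto_const_nhds hv) hv).const_smul _
  refine ((h4.add h5).congr fun k => ?_).trans_eq (by simp)
  have hk := (ht k).ne'
  simp only [map_smul, smul_apply, smul_sub, smul_smul]
  rw [show (t k ^ 2)⁻¹ * t k = (t k)⁻¹ by field_simp,
    show (t k ^ 2)⁻¹ * (2⁻¹ * (t k * t k)) = (2⁻¹ : ℝ) by field_simp]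
  abel

end SecondOrder

/-! ### First- and second-order limits along a sequence of solutions. -/

section Core

variable {P X E : Type*}
  [NormedAddCommGroup P] [InnerProductSpace ℝ P]
  [NormedAddCommGroup X] [InnerProductSpace ℝ X]
  [NormedAddCommGroup E] [InnerProductSpace ℝ E]
  {G : P × X → E} {f : P × X → StrongDual ℝ X} {K : ProperCone ℝ E} {z : P × X}

/-- Solutions of the multiplier system `f + ∇ₓG^* μ = 0`, `μ ∈ N_K(G)` along a sequence that
approaches `z` in the direction `(0, u)`, with step sizes `t`. -/
structure DirectionalSolutions (f : P × X → StrongDual ℝ X) (G : P × X → E) (K : ProperCone ℝ E)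
    (z : P × X) (u : X) (μ₀ : StrongDual ℝ E) (t : ℕ → ℝ) (v : ℕ → P × X)
    (μ : ℕ → StrongDual ℝ E) : Prop where
  contDiffAt_G : ContDiffAt ℝ 2 G z
  contDiffAt_f : ContDiffAt ℝ 1 f z
  map_eq_zero : G z = 0
  pos : ∀ k, 0 < t k
  tendsto_t : Tendsto t atTop (𝓝 0)
  tendsto_v : Tendsto v atTop (𝓝 (0, u))
  tendsto_μ : Tendsto μ atTop (𝓝 μ₀)
  map_mem : ∀ k, G (z + t k • v k) ∈ K
  mem_polar : ∀ k, μ k ∈ polar K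
  complementary : ∀ k, μ k (G (z + t k • v k)) = 0
  stationary : ∀ k, f (z + t k • v k) + (μ k).comp (partialX G (z + t k • v k)) = 0

/-- The functional `∇ₓf(z)u + ∇ₓ²⟨μ, G(·)⟩(z)u`. -/
noncomputable def lagrangeDeriv (f : P × X → StrongDual ℝ X) (G : P × X → E) (z : P × X)
    (μ : StrongDual ℝ E) (u : X) : StrongDual ℝ X :=
  partialX f z u + μ.comp ((fderiv ℝ (fderiv ℝ G) z (0, u)).comp (ContinuousLinearMap.inr ℝ P X))

theorem lagrangeDeriv_apply (μ : StrongDual ℝ E) (u w : X) :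
    lagrangeDeriv f G z μ u w =
      partialX f z u w + μ (fderiv ℝ (fderiv ℝ G) z (0, u) (0, w)) := rfl

namespace DirectionalSolutions

variable {u : X} {μ₀ : StrongDual ℝ E} {t : ℕ → ℝ} {v : ℕ → P × X} {μ : ℕ → StrongDual ℝ E}

theorem tendsto_point (H : DirectionalSolutions f G K z u μ₀ t v μ) :
    Tendsto (fun k => z + t k • v k) atTop (𝓝 z) := by
  simpa using (H.tendsto_t.smul H.tendsto_v).const_add z

theorem limit_mem_polar (H : DirectionalSolutions f G K z u μ₀ t v μ) : μ₀ ∈ polar K :=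
  (isClosed_polar K).mem_of_tendsto H.tendsto_μ (Eventually.of_forall H.mem_polar)

theorem tendsto_partialX (H : DirectionalSolutions f G K z u μ₀ t v μ) :
    Tendsto (fun k => partialX G (z + t k • v k)) atTop (𝓝 (partialX G z)) :=
  tendsto_clm_comp
    ((H.contDiffAt_G.fderiv_right (m := 1) (by norm_num)).continuousAt.tendsto.comp H.tendsto_point)
    tendsto_const_nhds

theorem limit_stationary (H : DirectionalSolutions f G K z u μ₀ t v μ) :
    f z + μ₀.comp (partialX G z) = 0 := by
  refine tendsto_nhds_unique ((H.contDiffAt_f.continuousAt.tendsto.comp H.tendsto_point).add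
    (tendsto_clm_comp H.tendsto_μ H.tendsto_partialX)) ?_
  exact tendsto_const_nhds.congr fun k => (H.stationary k).symm

theorem tendsto_difference_quotient (H : DirectionalSolutions f G K z u μ₀ t v μ) :
    Tendsto (fun k => (t k)⁻¹ • G (z + t k • v k)) atTop (𝓝 (partialX G z u)) := by
  have := tendsto_smul_sub_of_hasFDerivAt
    (H.contDiffAt_G.differentiableAt (by simp)).hasFDerivAt H.pos H.tendsto_t H.tendsto_v
  simpa [H.map_eq_zero, partialX] using this

theorem partialX_apply_mem (H : DirectionalSolutions f G K z u μ₀ t v μ) : partialX G z u ∈ K :=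
  K.isClosed.mem_of_tendsto H.tendsto_difference_quotient
    (Eventually.of_forall fun k => K.smul_mem (H.map_mem k) (inv_pos.2 (H.pos k)).le)

theorem limit_partialX_apply (H : DirectionalSolutions f G K z u μ₀ t v μ) :
    μ₀ (partialX G z u) = 0 := by
  refine tendsto_nhds_unique (tendsto_clm_apply H.tendsto_μ H.tendsto_difference_quotient) ?_
  exact tendsto_const_nhds.congr fun k => by simp [H.complementary k]

/-- Difference of the stationarity equations at `z + t k • v k` and at `z`, divided by `t k`.
Parameter derivatives drop out since the limit direction is `(0, u)`. -/
theorem tendsto_multiplier_quotient (H : DirectionalSolutions f G K z u μ₀ t v μ) :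
    Tendsto (fun k => (t k)⁻¹ • (μ k - μ₀).comp (partialX G z)) atTop
      (𝓝 (-lagrangeDeriv f G z μ₀ u)) := by
  have h1 := tendsto_smul_sub_of_hasFDerivAt
    (H.contDiffAt_f.differentiableAt (by simp)).hasFDerivAt H.pos H.tendsto_t H.tendsto_v
  have h2 := tendsto_smul_sub_of_hasFDerivAt
    (differentiableAt_fderiv_of_contDiffAt_two H.contDiffAt_G).hasFDerivAt H.pos H.tendsto_t
    H.tendsto_v
  have h3 := tendsto_clm_comp H.tendsto_μ
    (tendsto_clm_comp h2 (tendsto_const_nhds (x := ContinuousLinearMap.inr ℝ P X)))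
  refine (h1.add h3).neg.congr fun k => ?_
  have h4 := H.stationary k
  have h5 := H.limit_stationary
  ext w
  have h4' := DFunLike.congr_fun h4 w
  have h5' := DFunLike.congr_fun h5 w
  simp only [partialX, add_apply, ContinuousLinearMap.comp_apply, zero_apply, neg_apply,
    smul_apply, sub_apply, smul_eq_mul, map_smul, map_sub] at h4' h5' ⊢
  linear_combination (-(t k)⁻¹) * (h4' - h5')

theorem lagrangeDeriv_nonneg (H : DirectionalSolutions f G K z u μ₀ t v μ) {w : X}
    (hw : partialX G z w ∈ K) (hw0 : μ₀ (partialX G z w) = 0) :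
    0 ≤ lagrangeDeriv f G z μ₀ u w := by
  have := le_of_tendsto' (tendsto_clm_apply H.tendsto_multiplier_quotient
    (tendsto_const_nhds (x := w))) (b := 0) fun k => by
      simp only [smul_apply, ContinuousLinearMap.comp_apply, sub_apply, hw0, sub_zero, smul_eq_mul]
      exact mul_nonpos_of_nonneg_of_nonpos (inv_pos.2 (H.pos k)).le (H.mem_polar k _ hw)
  simpa using this

/-- By complementarity `-μ₀(G) = (μ' k - μ₀)(G)` along the sequence. After division by `t²`, the
second-order part vanishes as `μ' k → μ₀`, the `x`-part of the first-order term tends to `-⟨L u,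
u⟩`, with `L u = lagrangeDeriv f G z μ₀ u`, and `hp` disposes of the `p`-part. Only the image of `μ
k` under `∇ₓG(z)^*` matters, so `μ'` may be a better behaved choice. -/
theorem tendsto_limit_apply (H : DirectionalSolutions f G K z u μ₀ t v μ)
    {μ' : ℕ → StrongDual ℝ E} (hμ' : Tendsto μ' atTop (𝓝 μ₀))
    (hcompl : ∀ᶠ k in atTop, μ' k (G (z + t k • v k)) = 0)
    (hcomp : ∀ᶠ k in atTop, (μ' k).comp (partialX G z) = (μ k).comp (partialX G z))
    (hp : Tendsto (fun k => (t k)⁻¹ * (μ' k - μ₀) (partialP G z (v k).1)) atTop (𝓝 0)) :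
    Tendsto (fun k => ((t k) ^ 2)⁻¹ * μ₀ (G (z + t k • v k))) atTop
      (𝓝 (lagrangeDeriv f G z μ₀ u u)) := by
  have hv2 : Tendsto (fun k => (v k).2) atTop (𝓝 u) :=
    (continuous_snd.tendsto _).comp H.tendsto_v
  have h1 := (tendsto_clm_apply H.tendsto_multiplier_quotient hv2).add hp
  have h2 := tendsto_second_difference H.contDiffAt_G H.pos H.tendsto_t H.tendsto_v
  have h3 := tendsto_clm_apply (hμ'.sub_const μ₀) h2
  have h4 := (h1.add h3).neg
  simp only [sub_self, zero_apply, add_zero, neg_apply, neg_neg] at h4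
  refine h4.congr' ?_
  filter_upwards [hcompl, hcomp] with k hk1 hk2
  have hk3 := DFunLike.congr_fun hk2 (v k).2
  have hk4 : fderiv ℝ G z (v k) = partialP G z (v k).1 + partialX G z (v k).2 := by
    simp only [partialP, partialX, ContinuousLinearMap.comp_apply, ContinuousLinearMap.inl_apply,
      ContinuousLinearMap.inr_apply, ← map_add, Prod.mk_add_mk, add_zero, zero_add]
  simp only [H.map_eq_zero, sub_zero, hk4, smul_apply, ContinuousLinearMap.comp_apply, sub_apply,
    smul_eq_mul, map_sub, map_smul, map_add, hk1] at hk3 ⊢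
  linear_combination ((t k)⁻¹) * hk3

theorem lagrangeDeriv_eq_zero (H : DirectionalSolutions f G K z u μ₀ t v μ)
    (hlim : Tendsto (fun k => ((t k) ^ 2)⁻¹ * μ₀ (G (z + t k • v k))) atTop
      (𝓝 (lagrangeDeriv f G z μ₀ u u))) : lagrangeDeriv f G z μ₀ u u = 0 :=
  le_antisymm (le_of_tendsto' hlim fun k => mul_nonpos_of_nonneg_of_nonpos (by positivity)
    (H.limit_mem_polar _ (H.map_mem k)))
    (H.lagrangeDeriv_nonneg H.partialX_apply_mem H.limit_partialX_apply)

/-- For a competing `m`, the first-order terms of `m` and `μ₀` cancel, `m(G) ≤ 0`, and `t⁻² μ₀(G) →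
0`; what survives in the limit is half the difference of the objectives. -/
theorem maximal (H : DirectionalSolutions f G K z u μ₀ t v μ)
    (hlim : Tendsto (fun k => ((t k) ^ 2)⁻¹ * μ₀ (G (z + t k • v k))) atTop
      (𝓝 (lagrangeDeriv f G z μ₀ u u))) {m : StrongDual ℝ E} (hm : m ∈ polar K)
    (hmG : m.comp (fderiv ℝ G z) = μ₀.comp (fderiv ℝ G z)) :
    m (fderiv ℝ (fderiv ℝ G) z (0, u) (0, u)) ≤ μ₀ (fderiv ℝ (fderiv ℝ G) z (0, u) (0, u)) := by
  rw [H.lagrangeDeriv_eq_zero hlim] at hlim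
  have h1 := tendsto_second_difference H.contDiffAt_G H.pos H.tendsto_t H.tendsto_v
  have h2 := (tendsto_clm_apply (tendsto_const_nhds (x := m - μ₀)) h1).add hlim
  have h3 := le_of_tendsto' h2 (b := 0) fun k => by
    have hk := DFunLike.congr_fun hmG (v k)
    have hk2 := hm _ (H.map_mem k)
    simp only [ContinuousLinearMap.comp_apply] at hk
    have : (m - μ₀) (((t k) ^ 2)⁻¹ • (G (z + t k • v k) - G z) - (t k)⁻¹ • fderiv ℝ G z (v k)) +
        ((t k) ^ 2)⁻¹ * μ₀ (G (z + t k • v k)) = ((t k) ^ 2)⁻¹ * m (G (z + t k • v k)) := by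
      simp only [H.map_eq_zero, sub_zero, sub_apply, map_sub, map_smul, smul_eq_mul]
      linear_combination (-(t k)⁻¹) * hk
    rw [this]
    exact mul_nonpos_of_nonneg_of_nonpos (by positivity) hk2
  simp only [sub_apply, map_smul, smul_eq_mul, add_zero] at h3
  linarith

end DirectionalSolutions
end Core

/-! ### The parameter term in the characteristic-subspace and polyhedral cases. -/

section Extraction

variable {P X E : Type*}
  [NormedAddCommGroup P] [InnerProductSpace ℝ P]
  [NormedAddCommGroup X] [InnerProductSpace ℝ X]
  [NormedAddCommGroup E] [InnerProductSpace ℝ E] [FiniteDimensional ℝ E]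
  {G : P × X → E} {f : P × X → StrongDual ℝ X} {K : ProperCone ℝ E} {z : P × X}
  {u : X} {μ₀ : StrongDual ℝ E} {t : ℕ → ℝ} {v : ℕ → P × X} {μ : ℕ → StrongDual ℝ E}

namespace DirectionalSolutions

omit [FiniteDimensional ℝ E] in
theorem subseq (H : DirectionalSolutions f G K z u μ₀ t v μ) {φ : ℕ → ℕ} (hφ : StrictMono φ) :
    DirectionalSolutions f G K z u μ₀ (t ∘ φ) (v ∘ φ) (μ ∘ φ) where
  contDiffAt_G := H.contDiffAt_G
  contDiffAt_f := H.contDiffAt_f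
  map_eq_zero := H.map_eq_zero
  pos _ := H.pos _
  tendsto_t := H.tendsto_t.comp hφ.tendsto_atTop
  tendsto_v := H.tendsto_v.comp hφ.tendsto_atTop
  tendsto_μ := H.tendsto_μ.comp hφ.tendsto_atTop
  map_mem _ := H.map_mem _
  mem_polar _ := H.mem_polar _
  complementary _ := H.complementary _
  stationary _ := H.stationary _

omit [FiniteDimensional ℝ E] in
-- Polar functionals vanish on the lineality space, so for fixed `q` the quotient `t⁻¹ (μ k -
-- μ₀)(∇ₚG q)` reduces to the convergent `∇ₓG` quotient. Expanding `(v k).1 → 0` in a basis makes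
-- the product vanish.
theorem tendsto_of_partialP_mem [FiniteDimensional ℝ P]
    (H : DirectionalSolutions f G K z u μ₀ t v μ)
    (hP : ∀ q, partialP G z q ∈
      LinearMap.range (partialX G z : X →ₗ[ℝ] E) ⊔ K.toPointedCone.lineal) :
    Tendsto (fun k => ((t k) ^ 2)⁻¹ * μ₀ (G (z + t k • v k))) atTop
      (𝓝 (lagrangeDeriv f G z μ₀ u u)) := by
  refine H.tendsto_limit_apply H.tendsto_μ (Eventually.of_forall H.complementary)
    (Eventually.of_forall fun _ => rfl) ?_
  have hpt : ∀ q : P, ∃ r : ℝ,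
      Tendsto (fun k => (t k)⁻¹ * (μ k - μ₀) (partialP G z q)) atTop (𝓝 r) := by
    intro q
    obtain ⟨_, ⟨x, rfl⟩, e, ⟨he, he'⟩, hxe⟩ := Submodule.mem_sup.1 (hP q)
    have hzero : ∀ m ∈ polar K, m e = 0 := fun m hm =>
      le_antisymm (hm e he) (by simpa using hm (-e) he')
    refine ⟨_, (tendsto_clm_apply H.tendsto_multiplier_quotient
      (tendsto_const_nhds (x := x))).congr fun k => ?_⟩
    have hk := hzero _ (H.mem_polar k)
    have h0 := hzero _ H.limit_mem_polar
    rw [← hxe]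
    simp [hk, h0]
  choose r hr using hpt
  let b := Module.finBasis ℝ P
  have hv1 : Tendsto (fun k => (v k).1) atTop (𝓝 0) :=
    (continuous_fst.tendsto ((0 : P), u)).comp H.tendsto_v
  have hlim : Tendsto (fun k => ∑ i, b.coord i (v k).1 *
      ((t k)⁻¹ * (μ k - μ₀) (partialP G z (b i)))) atTop (𝓝 (∑ i, b.coord i 0 * r (b i))) :=
    tendsto_finsetSum _ fun i _ =>
      (((b.coord i).continuous_of_finiteDimensional.tendsto 0).comp hv1).mul (hr (b i))
  simp only [map_zero, zero_mul, Finset.sum_const_zero] at hlim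
  refine hlim.congr fun k => ?_
  conv_rhs => rw [← b.sum_repr (v k).1]
  simp only [map_sum, map_smul, smul_eq_mul, Finset.mul_sum, Module.Basis.coord_apply]
  exact Finset.sum_congr rfl fun i _ => by ring

/-- Coefficients over generators of the polar converge along a subsequence and can be corrected,
keeping `∇ₓG^* μ`, so that the new multipliers are `O(t)`-close to `μ₀`. Then their quotient by `t`
stays bounded while `(v k).1 → 0`. -/
theorem exists_tendsto_of_isPolyhedral (H : DirectionalSolutions f G K z u μ₀ t v μ)
    (hK : IsPolyhedral K) :
    ∃ φ : ℕ → ℕ, StrictMono φ ∧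
      Tendsto (fun k => ((t (φ k)) ^ 2)⁻¹ * μ₀ (G (z + t (φ k) • v (φ k)))) atTop
        (𝓝 (lagrangeDeriv f G z μ₀ u u)) := by
  obtain ⟨s, a, haK, hgen⟩ := hK.exists_polar_eq
  obtain ⟨C, hC0, hC⟩ := exists_bounded_nonneg_combination a
  have : ∀ k, ∃ c : s → ℝ, 0 ≤ c ∧ ∑ i, c i • a i = μ k ∧ ‖c‖ ≤ C * ‖μ k‖ := by
    intro k
    obtain ⟨c, hc, hcμ⟩ := hgen _ (H.mem_polar k)
    obtain ⟨c', h1, -, h3, h4⟩ := hC c hc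
    exact ⟨c', h1, h3.trans hcμ, by rwa [hcμ] at h4⟩
  choose c hc0 hcμ hcn using this
  obtain ⟨R, hR⟩ := (Metric.isBounded_range_of_tendsto _ H.tendsto_μ).exists_norm_le
  obtain ⟨c₀, -, φ, hφ, hlim⟩ := tendsto_subseq_of_bounded
    (Metric.isBounded_closedBall (x := (0 : s → ℝ)) (r := C * R)) (x := c) fun k => by
      rw [mem_closedBall_zero_iff]
      exact (hcn k).trans (mul_le_mul_of_nonneg_left (hR _ ⟨k, rfl⟩) hC0)
  refine ⟨φ, hφ, ?_⟩
  replace H := H.subseq hφ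
  have hsum : Continuous fun d : s → ℝ => ∑ i, d i • a i := by fun_prop
  have hμ₀ : ∑ i, c₀ i • a i = μ₀ :=
    tendsto_nhds_unique ((hsum.tendsto c₀).comp hlim)
      (H.tendsto_μ.congr fun k => (hcμ _).symm)
  let A : StrongDual ℝ E →ₗ[ℝ] StrongDual ℝ X :=
    { toFun := fun m => m.comp (partialX G z)
      map_add' := fun _ _ => rfl
      map_smul' := fun _ _ => rfl }
  have hA : ∀ m, A m = m.comp (partialX G z) := fun _ => rfl
  obtain ⟨D, hD⟩ := eventually_exists_combination_close a A (fun k => c (φ k)) c₀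
    (fun k => hc0 _) hlim (by
      simp only [hcμ, hμ₀, hA]
      exact tendsto_clm_comp H.tendsto_μ tendsto_const_nhds)
  simp only [hcμ, hμ₀, hA] at hD
  obtain ⟨c', hc'⟩ := hD.choice
  set M : ℝ := ∑ i, ‖a i‖ with hM
  have hdist : ∀ k, ‖∑ i, c' k i • a i - μ₀‖ ≤ ‖c' k - c₀‖ * M := by
    intro k
    rw [← hμ₀, ← Finset.sum_sub_distrib, hM, Finset.mul_sum]
    refine (norm_sum_le _ _).trans (Finset.sum_le_sum fun i _ => ?_)
    have hsub : c' k i • a i - c₀ i • a i = (c' k i - c₀ i) • a i := (sub_smul _ _ _).symm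
    rw [hsub, norm_smul]
    exact mul_le_mul_of_nonneg_right (norm_le_pi_norm (c' k - c₀) i) (norm_nonneg _)
  have hquot := H.tendsto_multiplier_quotient.norm
  have hM0 : 0 ≤ M := Finset.sum_nonneg fun i _ => norm_nonneg _
  have hbd : ∀ᶠ k in atTop, ‖∑ i, c' k i • a i - μ₀‖ ≤ t (φ k) *
      (D * ‖(t (φ k))⁻¹ • (μ (φ k) - μ₀).comp (partialX G z)‖ * M) := by
    filter_upwards [hc'] with k hk
    have ht := H.pos k
    simp only [Function.comp_apply] at ht
    refine (hdist k).trans ((mul_le_mul_of_nonneg_right hk.2.2.2 hM0).trans_eq ?_)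
    rw [norm_smul, norm_inv, Real.norm_of_nonneg ht.le, ContinuousLinearMap.sub_comp]
    field_simp
  have hright := ((hquot.const_mul D).mul_const M)
  refine H.tendsto_limit_apply (μ' := fun k => ∑ i, c' k i • a i) ?_ ?_ ?_ ?_
  · rw [tendsto_iff_norm_sub_tendsto_zero]
    refine squeeze_zero' (Eventually.of_forall fun _ => norm_nonneg _) hbd ?_
    simpa using H.tendsto_t.mul hright
  · filter_upwards [hc'] with k hk
    have h1 := H.complementary k
    simp only [Function.comp_apply] at h1 ⊢
    rw [← hcμ, sum_apply] at h1
    -- A vanishing sum of nonpositive terms: every active generator is complementary, and the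
    -- corrected multiplier uses no others.
    have h2 := (Finset.sum_eq_zero_iff_of_nonpos fun i _ =>
      mul_nonpos_of_nonneg_of_nonpos (hc0 (φ k) i) (haK i _ (H.map_mem k))).1 h1
    rw [sum_apply]
    refine Finset.sum_eq_zero fun i hi => ?_
    rcases mul_eq_zero.1 (h2 i hi) with h | h
    · simp [hk.2.1 i h]
    · exact mul_eq_zero_of_right _ h
  · filter_upwards [hc'] with k hk using hk.2.2.1
  · have hv1 : Tendsto (fun k => ‖partialP G z (v (φ k)).1‖) atTop (𝓝 0) := by
      have h1 : Tendsto (fun k => (v (φ k)).1) atTop (𝓝 0) :=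
        (continuous_fst.tendsto ((0 : P), u)).comp H.tendsto_v
      simpa using (((partialP G z).continuous.tendsto 0).comp h1).norm
    have hzero := hright.mul hv1
    rw [mul_zero] at hzero
    refine squeeze_zero_norm' ?_ hzero
    filter_upwards [hbd] with k hk
    have ht := H.pos k
    simp only [Function.comp_apply] at ht ⊢
    rw [norm_mul, norm_inv, Real.norm_of_nonneg ht.le, inv_mul_le_iff₀ ht]
    refine (ContinuousLinearMap.le_opNorm _ _).trans ?_
    exact (mul_le_mul_of_nonneg_right hk (norm_nonneg _)).trans_eq (mul_assoc _ _ _)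

end DirectionalSolutions
end Extraction

/-! ### Translating `F` and the directional objective into derivatives of `h ∘ g`. -/

section Calculus

variable {P X Y E : Type*}
  [NormedAddCommGroup P] [InnerProductSpace ℝ P]
  [NormedAddCommGroup X] [InnerProductSpace ℝ X]
  [NormedAddCommGroup Y] [InnerProductSpace ℝ Y]
  [NormedAddCommGroup E] [InnerProductSpace ℝ E]
  {f : P × X → StrongDual ℝ X} {g : P × X → Y} {h : Y → E} {z : P × X}

theorem hasFDerivAt_slice {F : Type*} [NormedAddCommGroup F] [NormedSpace ℝ F] {G : P × X → F}
    (hG : DifferentiableAt ℝ G z) : HasFDerivAt (fun x => G (z.1, x)) (partialX G z) z.2 :=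
  HasFDerivAt.comp (g := G) z.2 hG.hasFDerivAt (hasFDerivAt_prodMk_right z.1 z.2)

theorem partialX_comp (hg : DifferentiableAt ℝ g z) (hh : DifferentiableAt ℝ h (g z)) :
    partialX (h ∘ g) z = (fderiv ℝ h (g z)).comp (partialX g z) := by
  rw [partialX, fderiv_comp z hh hg, partialX, ContinuousLinearMap.comp_assoc]

omit [NormedAddCommGroup P] [InnerProductSpace ℝ P] [NormedAddCommGroup X]
  [InnerProductSpace ℝ X] in
theorem curvature_comp_apply {y : Y} (hh : ContDiffAt ℝ 2 h y)
    (hs : Function.Surjective (fderiv ℝ h y)) (μ : StrongDual ℝ E) (v w : Y) :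
    curvature h y (μ.comp (fderiv ℝ h y)) v w = μ (fderiv ℝ (fderiv ℝ h) y v w) := by
  rw [curvature, reducedMultiplier_comp hs, hessian]
  exact fderiv_fderiv_clm_comp μ hh v w

theorem fderiv_fderiv_slice {F : Type*} [NormedAddCommGroup F] [NormedSpace ℝ F] {G : P × X → F}
    (hG : ContDiffAt ℝ 2 G z) (u w : X) :
    fderiv ℝ (fderiv ℝ fun x => G (z.1, x)) z.2 u w =
      fderiv ℝ (fderiv ℝ G) z (0, u) (0, w) := by
  have hj : fderiv ℝ (fun x : X => (z.1, x)) = fun _ => ContinuousLinearMap.inr ℝ P X := by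
    ext1 x
    exact (hasFDerivAt_prodMk_right z.1 x).fderiv
  have := fderiv_fderiv_comp (h := G) (g := fun x : X => (z.1, x)) (z := z.2) hG
    (contDiff_prodMk_right z.1).contDiffAt u w
  rw [hj] at this
  simpa [Function.comp_def] using this

theorem opF_comp_apply (hg : ContDiffAt ℝ 2 g z) (hh : ContDiffAt ℝ 2 h (g z))
    (hs : Function.Surjective (fderiv ℝ h (g z))) (μ : StrongDual ℝ E) (u w : X) :
    opF f g h z (μ.comp (fderiv ℝ h (g z))) u w = lagrangeDeriv f (h ∘ g) z μ u w := by
  rw [lagrangeDeriv_apply, fderiv_fderiv_comp hh hg, opF]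
  simp only [add_apply, ContinuousLinearMap.bilinearComp_apply, curvature_comp_apply hh hs, hessian]
  rw [fderiv_fderiv_slice (G := fun z' => (μ.comp (fderiv ℝ h (g z))) (g z'))
    ((ContinuousLinearMap.contDiff _).contDiffAt.comp z hg), fderiv_fderiv_clm_comp _ hg]
  simp only [ContinuousLinearMap.comp_apply, map_add, partialX, ContinuousLinearMap.inr_apply]
  ring

theorem dirObjective_comp (hg : ContDiffAt ℝ 2 g z) (hh : ContDiffAt ℝ 2 h (g z))
    (hs : Function.Surjective (fderiv ℝ h (g z))) (μ : StrongDual ℝ E) (v : P × X) :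
    dirObjective g h z v (μ.comp (fderiv ℝ h (g z))) =
      μ (fderiv ℝ (fderiv ℝ (h ∘ g)) z v v) := by
  rw [dirObjective, curvature_comp_apply hh hs, fderiv_fderiv_comp hh hg, map_add, add_comm]
  rfl

end Calculus

/-! ### Multipliers at nearby solutions, critical directions and failure of calmness. -/

section Solutions

variable {P X Y E : Type*}
  [NormedAddCommGroup P] [InnerProductSpace ℝ P]
  [NormedAddCommGroup X] [InnerProductSpace ℝ X]
  [NormedAddCommGroup Y] [InnerProductSpace ℝ Y] [FiniteDimensional ℝ Y]
  [NormedAddCommGroup E] [InnerProductSpace ℝ E] [FiniteDimensional ℝ E]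
  {f : P × X → StrongDual ℝ X} {g : P × X → Y} {C : Set Y} {K : ProperCone ℝ E} {h : Y → E}
  {z : P × X}

omit [FiniteDimensional ℝ Y] [FiniteDimensional ℝ E] in
theorem contDiffAt_comp_reduction (hg : ContDiffAt ℝ 2 g z)
    (hred : IsConeReduction C (g z) K h) : ContDiffAt ℝ 2 (h ∘ g) z :=
  hred.contDiffAt.comp z hg

/-- Near `z`, solutions satisfy the multiplier system with multipliers bounded by a multiple of
`‖f‖`. -/
theorem RobinsonStable.exists_multiplier_of_mem_solutionMap (hRS : RobinsonStable g C z)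
    (hg : ContDiffAt ℝ 2 g z) (hred : IsConeReduction C (g z) K h) :
    ∃ κ : ℝ, 0 ≤ κ ∧ ∀ᶠ z' in 𝓝 z, z'.2 ∈ solutionMap f g C z'.1 →
      h (g z') ∈ K ∧ ∃ μ ∈ polar K, μ (h (g z')) = 0 ∧
        f z' + μ.comp (partialX (h ∘ g) z') = 0 ∧ ‖μ‖ ≤ κ * ‖f z'‖ := by
  obtain ⟨κ, hκ, hreg⟩ := hRS.exists_localErrorBound hg.continuousAt hred
  have hmem : ∀ᶠ z' in 𝓝 z, g z' ∈ C → h (g z') ∈ K :=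
    hg.continuousAt.eventually (hred.eventually_mem_iff.mono fun _ h => h.1)
  refine ⟨κ, hκ, ?_⟩
  filter_upwards [hreg, hmem, eventually_eventually_nhds.2 hmem,
    (contDiffAt_comp_reduction hg hred).eventually (by simp)] with z' h1 h2 h3 h4
  rintro ⟨ν, hν, hfν⟩
  have hslice : ContDiffAt ℝ 1 (fun x => h (g (z'.1, x))) z'.2 :=
    ContDiffAt.comp (g := h ∘ g) z'.2 (h4.of_le (by norm_num))
      (contDiff_prodMk_right z'.1).contDiffAt
  have hfd : fderiv ℝ (fun x => h (g (z'.1, x))) z'.2 = partialX (h ∘ g) z' :=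
    (hasFDerivAt_slice (h4.differentiableAt (by simp))).fderiv
  have hc : Continuous fun x : X => (z'.1, x) := by fun_prop
  obtain ⟨μ, hμ, h0, hcomp, hn⟩ := h1.exists_multiplier hκ hslice
    ((hc.tendsto z'.2).eventually h3) hν
  have hνf : ν = -f z' := (neg_eq_of_add_eq_zero_right hfν.symm).symm
  refine ⟨h2 hν.1, μ, hμ, h0, ?_, ?_⟩
  · rw [hfd] at hcomp
    rw [hcomp, hνf]
    exact add_neg_cancel _
  · rwa [hνf, norm_neg] at hn

/-- The error bound makes the contingent cone equal to the linearized cone. -/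
theorem RobinsonStable.mem_criticalCone_iff (hRS : RobinsonStable g C z)
    (hg : ContDiffAt ℝ 2 g z) (hred : IsConeReduction C (g z) K h) {u : X} :
    u ∈ criticalCone (feasible g C z.1) z.2 (-f z) ↔
      partialX (h ∘ g) z u ∈ K ∧ f z u = 0 := by
  obtain ⟨κ, hκ, hreg⟩ := hRS.exists_localErrorBound hg.continuousAt hred
  have hd : HasFDerivAt (fun x => h (g (z.1, x))) (partialX (h ∘ g) z) z.2 :=
    hasFDerivAt_slice ((contDiffAt_comp_reduction hg hred).differentiableAt (by simp))
  have hmem : ∀ᶠ z' in 𝓝 z, g z' ∈ C → h (g z') ∈ K :=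
    hg.continuousAt.eventually (hred.eventually_mem_iff.mono fun _ h => h.1)
  have hc : Continuous fun x : X => (z.1, x) := by fun_prop
  have hT : u ∈ posTangentConeAt (feasible g C z.1) z.2 ↔ partialX (h ∘ g) z u ∈ K :=
    ⟨fun hu => map_mem_of_mem_posTangentConeAt hd hred.map_eq_zero
      ((hc.tendsto z.2).eventually hmem) hu,
    fun hu => hreg.self_of_nhds.mem_posTangentConeAt hκ hd
      (by rw [hred.map_eq_zero]; exact K.zero_mem) hu⟩
  rw [criticalCone, Set.mem_inter_iff, hT]
  simp

theorem exists_directionalSolutions [FiniteDimensional ℝ X] (hg : ContDiffAt ℝ 2 g z)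
    (hred : IsConeReduction C (g z) K h) (hf : ContDiffAt ℝ 1 f z) (hRS : RobinsonStable g C z)
    (hnot : ¬ IsolatedlyCalm (solutionMap f g C) z.1 z.2) :
    ∃ u : X, u ≠ 0 ∧ ∃ μ₀ t v μ, DirectionalSolutions f (h ∘ g) K z u μ₀ t v μ := by
  obtain ⟨κ, hκ, hev⟩ := hRS.exists_multiplier_of_mem_solutionMap (f := f) hg hred
  have hfb : ∀ᶠ z' in 𝓝 z, ‖f z'‖ < ‖f z‖ + 1 :=
    hf.continuousAt.norm.eventually_lt_const (by linarith)
  obtain ⟨r, hr, hball⟩ := Metric.eventually_nhds_iff_ball.1 (hev.and hfb)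
  -- Calmness is refuted with constant `n + 1` on shrinking neighborhoods, so the parameter
  -- displacement is of smaller order than the displacement of `x`.
  have hseq : ∀ n : ℕ, ∃ z' : P × X, z' ∈ Metric.ball z r ∧ ‖z'.2 - z.2‖ < 1 / ((n : ℝ) + 1) ∧
      z'.2 ∈ solutionMap f g C z'.1 ∧ ((n : ℝ) + 1) * ‖z'.1 - z.1‖ < ‖z'.2 - z.2‖ := by
    intro n
    by_contra hcon
    push Not at hcon
    have hn : (0 : ℝ) < 1 / ((n : ℝ) + 1) := by positivity
    refine hnot ⟨(n : ℝ) + 1, by positivity, Metric.ball z.1 r, Metric.ball_mem_nhds _ hr,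
      Metric.ball z.2 (min r (1 / ((n : ℝ) + 1))), Metric.ball_mem_nhds _ (lt_min hr hn), ?_⟩
    rintro p hp x ⟨hx, hxU⟩
    rw [Metric.mem_ball, lt_min_iff] at hxU
    rw [Metric.mem_closedBall, dist_eq_norm]
    refine hcon (p, x) ?_ (by rw [← dist_eq_norm]; exact hxU.2) hx
    rw [Metric.mem_ball, Prod.dist_eq]
    exact max_lt hp hxU.1
  choose w hwr hwn hws hwl using hseq
  have hmul := fun n => (hball _ (hwr n)).1 (hws n)
  choose hwK m hmK hm0 hms hmn using hmul
  set t : ℕ → ℝ := fun n => ‖(w n).2 - z.2‖ with ht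
  have htpos : ∀ n, 0 < t n := fun n => lt_of_le_of_lt (by positivity) (hwl n)
  have ht0 : Tendsto t atTop (𝓝 0) := squeeze_zero (fun n => (htpos n).le)
    (fun n => (hwn n).le) tendsto_one_div_add_atTop_nhds_zero_nat
  set v : ℕ → P × X := fun n => (t n)⁻¹ • (w n - z) with hv
  have hzv : ∀ n, z + t n • v n = w n := fun n => by
    rw [hv, smul_smul, mul_inv_cancel₀ (htpos n).ne', one_smul, add_sub_cancel]
  have hv1 : Tendsto (fun n => (v n).1) atTop (𝓝 0) := by
    refine squeeze_zero_norm (fun n => ?_) tendsto_one_div_add_atTop_nhds_zero_nat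
    have : (v n).1 = (t n)⁻¹ • ((w n).1 - z.1) := rfl
    rw [this, norm_smul, norm_inv, Real.norm_of_nonneg (htpos n).le, inv_mul_le_iff₀ (htpos n),
      mul_one_div, le_div_iff₀ (by positivity), mul_comm]
    exact (hwl n).le
  have hv2 : ∀ n, ‖(v n).2‖ = 1 := fun n => by
    have : (v n).2 = (t n)⁻¹ • ((w n).2 - z.2) := rfl
    rw [this, norm_smul, norm_inv, Real.norm_of_nonneg (htpos n).le]
    exact inv_mul_cancel₀ (htpos n).ne'
  have hmb : ∀ n, ‖m n‖ ≤ κ * (‖f z‖ + 1) := fun n =>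
    (hmn n).trans (mul_le_mul_of_nonneg_left (hball _ (hwr n)).2.le hκ)
  obtain ⟨⟨u, μ₀⟩, -, φ, hφ, hlim⟩ := tendsto_subseq_of_bounded
    ((Metric.isBounded_closedBall (x := (0 : X)) (r := 1)).prod
      (Metric.isBounded_closedBall (x := (0 : StrongDual ℝ E)) (r := κ * (‖f z‖ + 1))))
    (x := fun n => ((v n).2, m n)) fun n => by
      refine ⟨?_, ?_⟩
      · rw [mem_closedBall_zero_iff]; exact (hv2 n).le
      · rw [mem_closedBall_zero_iff]; exact hmb n
  have hu : Tendsto (fun n => (v (φ n)).2) atTop (𝓝 u) := (continuous_fst.tendsto _).comp hlim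
  have hμ : Tendsto (fun n => m (φ n)) atTop (𝓝 μ₀) := (continuous_snd.tendsto _).comp hlim
  refine ⟨u, ?_, μ₀, t ∘ φ, v ∘ φ, m ∘ φ, ?_⟩
  · rintro rfl
    have := tendsto_nhds_unique hu.norm (tendsto_const_nhds.congr fun n => (hv2 (φ n)).symm)
    simp at this
  · exact
      { contDiffAt_G := contDiffAt_comp_reduction hg hred
        contDiffAt_f := hf
        map_eq_zero := hred.map_eq_zero
        pos := fun k => htpos _
        tendsto_t := ht0.comp hφ.tendsto_atTop
        tendsto_v := (hv1.comp hφ.tendsto_atTop).prodMk_nhds hu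
        tendsto_μ := hμ
        map_mem := fun k => by simp only [Function.comp_apply, hzv]; exact hwK _
        mem_polar := fun k => hmK _
        complementary := fun k => by simp only [Function.comp_apply, hzv]; exact hm0 _
        stationary := fun k => by simp only [Function.comp_apply, hzv]; exact hms _ }

/-- Under strict complementarity, `∇ₓ(h ∘ g)(z)` maps critical directions to the lineality space
of `K`. -/
theorem StrictComplementarity.neg_partialX_apply_mem
    (hSC : StrictComplementarity (fun x => g (z.1, x)) C z.2 (-f z))
    (hg : ContDiffAt ℝ 2 g z) (hred : IsConeReduction C (g z) K h) {w : X}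
    (hwK : partialX (h ∘ g) z w ∈ K) (hw : f z w = 0) : -partialX (h ∘ g) z w ∈ K := by
  obtain ⟨l, hl, hlf⟩ := hSC
  rw [(hasFDerivAt_slice (hg.differentiableAt (by simp))).fderiv] at hlf
  have hlw : l (partialX g z w) = 0 := by
    have := DFunLike.congr_fun hlf w
    simpa [hw] using this
  rw [partialX_comp (hg.differentiableAt (by simp))
    (hred.contDiffAt.differentiableAt (by simp))] at hwK ⊢
  refine mem_of_forall_polar K fun μ hμ => ?_
  -- The prolonged point is still a normal, hence nonpositive on the image of `w`; as `l` vanishes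
  -- there, this forces `μ ≥ 0` there.
  obtain ⟨ε, hε, hmem⟩ := exists_add_smul_sub_mem_of_mem_intrinsicInterior hl
    (hred.mem_normalCone_iff.2 ⟨μ, hμ, rfl⟩)
  obtain ⟨μ₂, hμ₂, hcomp⟩ := hred.mem_normalCone_iff.1 hmem
  have h1 := DFunLike.congr_fun hcomp (partialX g z w)
  have h2 := hμ₂ _ hwK
  simp only [ContinuousLinearMap.comp_apply, add_apply, smul_apply, sub_apply, smul_eq_mul,
    hlw] at h1 h2
  rw [map_neg, neg_nonpos, ContinuousLinearMap.comp_apply]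
  nlinarith

end Solutions

/-! ### Contradiction with the second-order conditions. -/

section Isolated

variable {P X Y E : Type*}
  [NormedAddCommGroup P] [InnerProductSpace ℝ P]
  [NormedAddCommGroup X] [InnerProductSpace ℝ X]
  [NormedAddCommGroup Y] [InnerProductSpace ℝ Y] [FiniteDimensional ℝ Y]
  [NormedAddCommGroup E] [InnerProductSpace ℝ E] [FiniteDimensional ℝ E]
  {f : P × X → StrongDual ℝ X} {g : P × X → Y} {C : Set Y} {K : ProperCone ℝ E} {h : Y → E}
  {z : P × X} {u : X} {μ₀ : StrongDual ℝ E} {t : ℕ → ℝ} {v : ℕ → P × X}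
  {μ : ℕ → StrongDual ℝ E}

namespace DirectionalSolutions

theorem mem_criticalCone (H : DirectionalSolutions f (h ∘ g) K z u μ₀ t v μ)
    (hg : ContDiffAt ℝ 2 g z) (hred : IsConeReduction C (g z) K h) (hRS : RobinsonStable g C z) :
    u ∈ criticalCone (feasible g C z.1) z.2 (-f z) := by
  refine (hRS.mem_criticalCone_iff hg hred).2 ⟨H.partialX_apply_mem, ?_⟩
  simpa [H.limit_partialX_apply] using DFunLike.congr_fun H.limit_stationary u

theorem mem_systemMultipliers (H : DirectionalSolutions f (h ∘ g) K z u μ₀ t v μ)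
    (hg : ContDiffAt ℝ 2 g z) (hred : IsConeReduction C (g z) K h) :
    μ₀.comp (fderiv ℝ h (g z)) ∈ systemMultipliers f g C z := by
  refine ⟨hred.mem_normalCone_iff.2 ⟨μ₀, H.limit_mem_polar, rfl⟩, ?_⟩
  rw [ContinuousLinearMap.comp_assoc, ← partialX_comp (hg.differentiableAt (by simp))
    (hred.contDiffAt.differentiableAt (by simp))]
  exact H.limit_stationary

theorem opF_nonneg (H : DirectionalSolutions f (h ∘ g) K z u μ₀ t v μ)
    (hg : ContDiffAt ℝ 2 g z) (hred : IsConeReduction C (g z) K h) (hRS : RobinsonStable g C z)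
    {w : X} (hw : w ∈ criticalCone (feasible g C z.1) z.2 (-f z)) :
    0 ≤ opF f g h z (μ₀.comp (fderiv ℝ h (g z))) u w := by
  rw [opF_comp_apply hg hred.contDiffAt hred.surjective]
  obtain ⟨h1, h2⟩ := (hRS.mem_criticalCone_iff hg hred).1 hw
  refine H.lagrangeDeriv_nonneg h1 ?_
  simpa [h2] using DFunLike.congr_fun H.limit_stationary w

theorem mem_dirMultipliers (H : DirectionalSolutions f (h ∘ g) K z u μ₀ t v μ)
    (hg : ContDiffAt ℝ 2 g z) (hred : IsConeReduction C (g z) K h)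
    (hlim : Tendsto (fun k => ((t k) ^ 2)⁻¹ * μ₀ ((h ∘ g) (z + t k • v k))) atTop
      (𝓝 (lagrangeDeriv f (h ∘ g) z μ₀ u u))) :
    μ₀.comp (fderiv ℝ h (g z)) ∈
      dirMultipliers g C h z ((μ₀.comp (fderiv ℝ h (g z))).comp (fderiv ℝ g z)) (0, u) := by
  refine ⟨⟨hred.mem_normalCone_iff.2 ⟨μ₀, H.limit_mem_polar, rfl⟩, rfl⟩, ?_⟩
  rintro l' ⟨hl', hcomp⟩
  obtain ⟨m, hm, rfl⟩ := hred.mem_normalCone_iff.1 hl'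
  rw [dirObjective_comp hg hred.contDiffAt hred.surjective,
    dirObjective_comp hg hred.contDiffAt hred.surjective]
  refine H.maximal hlim hm ?_
  rwa [fderiv_comp z (hred.contDiffAt.differentiableAt (by simp)) (hg.differentiableAt (by simp)),
    ← ContinuousLinearMap.comp_assoc, ← ContinuousLinearMap.comp_assoc]

/-- The single functional `μ₀ ∘ ∇h` serves both as the system multiplier and as the directional
maximizer. -/
theorem not_secondOrderCondition (H : DirectionalSolutions f (h ∘ g) K z u μ₀ t v μ)
    (hu : u ≠ 0) (hg : ContDiffAt ℝ 2 g z) (hred : IsConeReduction C (g z) K h)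
    (hRS : RobinsonStable g C z)
    (hlim : Tendsto (fun k => ((t k) ^ 2)⁻¹ * μ₀ ((h ∘ g) (z + t k • v k))) atTop
      (𝓝 (lagrangeDeriv f (h ∘ g) z μ₀ u u))) :
    ¬ SecondOrderCondition f g C h z := by
  intro hSOC
  rcases hSOC u (H.mem_criticalCone hg hred hRS) hu _ (H.mem_systemMultipliers hg hred) _
    (H.mem_dirMultipliers hg hred hlim) with hpos | ⟨w, hw, hneg⟩
  · rw [opF_comp_apply hg hred.contDiffAt hred.surjective, H.lagrangeDeriv_eq_zero hlim] at hpos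
    exact hpos.false
  · exact (H.opF_nonneg hg hred hRS hw).not_gt hneg

/-- Strict complementarity makes `-u` critical, so nonnegativity on critical directions, tested at
`-u`, excludes a positive quadratic form. -/
theorem not_strongSecondOrderCondition (H : DirectionalSolutions f (h ∘ g) K z u μ₀ t v μ)
    (hu : u ≠ 0) (hg : ContDiffAt ℝ 2 g z) (hred : IsConeReduction C (g z) K h)
    (hRS : RobinsonStable g C z)
    (hSC : StrictComplementarity (fun x => g (z.1, x)) C z.2 (-f z)) :
    ¬ StrongSecondOrderCondition f g C h z := by
  intro hSOC
  have hcrit := H.mem_criticalCone hg hred hRS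
  rcases hSOC u hcrit hu _ (H.mem_systemMultipliers hg hred) with hpos | ⟨w, hw, hneg⟩
  · obtain ⟨h1, h2⟩ := (hRS.mem_criticalCone_iff hg hred).1 hcrit
    have hmem : -u ∈ criticalCone (feasible g C z.1) z.2 (-f z) :=
      (hRS.mem_criticalCone_iff hg hred).2
        ⟨by rw [map_neg]; exact hSC.neg_partialX_apply_mem hg hred h1 h2, by simp [h2]⟩
    have := H.opF_nonneg hg hred hRS hmem
    rw [map_neg] at this
    linarith
  · exact (H.opF_nonneg hg hred hRS hw).not_gt hneg

end DirectionalSolutions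
end Isolated
end ParamVar

open ParamVar
theorem mainTheorem7
    {P X Y E : Type*}
    [NormedAddCommGroup P] [InnerProductSpace ℝ P] [FiniteDimensional ℝ P]
    [NormedAddCommGroup X] [InnerProductSpace ℝ X] [FiniteDimensional ℝ X]
    [NormedAddCommGroup Y] [InnerProductSpace ℝ Y] [FiniteDimensional ℝ Y]
    [NormedAddCommGroup E] [InnerProductSpace ℝ E] [FiniteDimensional ℝ E]
    (g : P × X → Y) (C : Set Y) (K : ProperCone ℝ E) (h : Y → E)
    (f : P × X → StrongDual ℝ X) (pbar : P) (xbar : X)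
    (hg : ContDiffAt ℝ 2 g (pbar, xbar))
    (hred : IsConeReduction C (g (pbar, xbar)) K h)
    (hf : ContDiffAt ℝ 1 f (pbar, xbar))
    (hsol : xbar ∈ solutionMap f g C pbar)
    (hRS : RobinsonStable g C (pbar, xbar))
    (hcases :
      (SecondOrderCondition f g C h (pbar, xbar) ∧
        (charSubspace g h K (pbar, xbar) = ⊤ ∨ IsPolyhedral K)) ∨
      (StrictComplementarity (fun x => g (pbar, x)) C xbar (-f (pbar, xbar)) ∧
        StrongSecondOrderCondition f g C h (pbar, xbar))) :
    IsolatedlyCalm (solutionMap f g C) pbar xbar := by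
  by_contra hnot
  obtain ⟨u, hu, μ₀, t, v, μ, H⟩ := exists_directionalSolutions hg hred hf hRS hnot
  rcases hcases with ⟨hSOC, hP | hK⟩ | ⟨hSC, hSOC⟩
  · refine H.not_secondOrderCondition hu hg hred hRS (H.tendsto_of_partialP_mem fun q => ?_) hSOC
    have : q ∈ charSubspace g h K (pbar, xbar) := hP ▸ Submodule.mem_top
    exact this
  · obtain ⟨φ, hφ, hlim⟩ := H.exists_tendsto_of_isPolyhedral hK
    exact (H.subseq hφ).not_secondOrderCondition hu hg hred hRS hlim hSOC
  · exact H.not_strongSecondOrderCondition hu hg hred hRS hSC hSOC
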